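/- **Setting.** Let $n\ge 1$ and $\alpha=(\alpha_1,\dots,\alpha_n)\in(\mathbb N\cup\{0\})^n$, and put $J=\{j:\alpha_j\ne 0\}$. The Grushin space $\mathbb G^{n+1}_\alpha$ is $\mathbb R^{n+1}$ with the sub-Riemannian structure given by the vector fields $X_j=\xi_j\partial_{x_j}$, $\xi_j(x)=\prod_{i<j}x_i^{\alpha_i}$ ($1\le j\le n+1$), with Hamiltonian $H(x,p)=\frac12\sum_{j=1}^{n+1}\xi_j(x)^2p_j^2$. A point $x^0$ is *Riemannian* if the $X_j(x^0)$ span $\mathbb R^{n+1}$ (equivalently $x^0_j\neq0$ for all $j\in J$). For a covector $p^0$ let $t\mapsto x(t;p^0)$ be the geodesic from $x^0$ with initial covector $p^0$, i.e. the $x$-component of the solution of $x'=\partial H/\partial p$, $p'=-\partial H/\partial x$ with $x(0)=x^0$, $p(0)=p^0$. Let $\exp_{x^0}(p^0)=x(1;p^0)$, and define the (first) conjugate time $$t_{\rm con}(p^0)=\inf\{t>0:\ \exp_{x^0}\text{ has a critical point at }tp^0\}\in[0,+\infty],\qquad \inf\emptyset=+\infty .$$ For an integer $a\ge1$ let $F_a(x)=\int_0^x(1-t^{2a})^{-1/2}\,dt$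 on $[0,1]$ and $\pi_a=2F_a(1)$. Let $\sin_a$ be the inverse of $F_a$ on $[0,\pi_a/2]$, extended to $[0,\pi_a]$ by $\sin_a(\pi_a-y)=\sin_a(y)$ and then to $\mathbb R$ as an odd $2\pi_a$-periodic function, and let $\cos_a=\sin_a'$. Let $\rho_a(y)=|y|^{a-1}y$. *Generalized spherical coordinates.* Let $\tilde\alpha_j=\alpha_j$, $\tilde x^0_j=x^0_j$ for $j\in J$ and $\tilde\alpha_j=1$, $\tilde x^0_j=1$ for $j\notin J$, $1\le j\le n$. Let $\mathcal R^0_\alpha$ be the set of $\phi=(\phi_1,\dots,\phi_n)\in\prod_{j\le n-1}[0,\pi_{\tilde\alpha_j}]\times[0,2\pi_{\tilde\alpha_n})$ with $\sin_{\tilde\alpha_j}(\phi_j)\ne0$ for all $j$. For a Riemannian point $x^0$ and $\phi\in\mathcal R^0_\alpha$ put $\delta_j=\rho_{\tilde\alpha_j}\big(\sin_{\tilde\alpha_j}(\phi_j)/\tilde x^0_j\big)$ and define $p^0=p^0(\phi)\in H(x^0,\cdot)^{-1}(1/2)$ by $$p^0_j=\cos_{\tilde\alpha_j}(\phi_j)\prod_{i<j}\delta_i\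 \ (1\le j\le n),\qquad p^0_{n+1}=\prod_{i\le n}\delta_i .$$ The corresponding (non-trivial, arc length parametrized) geodesic is $x(t)=x(t;p^0(\phi))$. For $j\in J$ put $$\omega_j=\frac{\sin_{\alpha_j}(\phi_j)}{x^0_j}\prod_{i<j}\delta_i,\qquad \tau_j=\min\Big\{t>0:\ |\omega_j|\int_0^t\xi_j(x(s))^2\,ds=\pi_{\alpha_j}\Big\},\qquad \tau=\min_{j\in J}\tau_j,$$ with $\tau=+\infty$ if $J=\emptyset$. **Theorem.** Let $x^0\in\mathbb G^{n+1}_\alpha$ be a Riemannian point, $\phi\in\mathcal R^0_\alpha$, and $t_{\rm con}=t_{\rm con}(p^0(\phi))$. Then the minima $\tau_j$, $j\in J$, exist, and $$0<\tau\le t_{\rm con}.$$ Moreover, if $J\neq\emptyset$, then $\tau=t_{\rm con}$ if and only if there is $j\in J$ such that $\tau=\tau_j$ and $\phi_j=\pi_{\alpha_j}/2$ or $\phi_j=3\pi_{\alpha_j}/2$. -/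

import Mathlib

namespace Grushin

noncomputable section

/-! ### Generalized trigonometric functions `sin_α = sin_{2α,2}`, for `α ≥ 1` -/

/-- `F_{2α,2}(x) = ∫₀ˣ (1 - t^{2α})^{-1/2} dt`, used for `x ∈ [0,1]`. -/
def arcLen (α : ℕ) (x : ℝ) : ℝ :=
  ∫ t in (0 : ℝ)..x, 1 / Real.sqrt (1 - t ^ (2 * α))

/-- `π_α = 2 F_{2α,2}(1)`. -/
def genPi (α : ℕ) : ℝ := 2 * arcLen α 1

/-- The inverse of `F_{2α,2} : [0,1] → [0, π_α/2]`, used on `[0, π_α/2]`. -/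
def sinQuarter (α : ℕ) : ℝ → ℝ :=
  Function.invFunOn (arcLen α) (Set.Icc 0 1)

/-- The function `sin_α` on `[0, 2π_α]`: reflected about `π_α/2`, then continued by
`sin_α (π_α + y) = - sin_α y`. -/
def sinPeriod (α : ℕ) (z : ℝ) : ℝ :=
  if z ≤ genPi α / 2 then sinQuarter α z
  else if z ≤ genPi α then sinQuarter α (genPi α - z)
  else if z ≤ 3 * genPi α / 2 then -sinQuarter α (z - genPi α)
  else -sinQuarter α (2 * genPi α - z)

/-- `sin_α` on the whole line, the odd, `2π_α`-periodic extension. -/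
def genSin (α : ℕ) (y : ℝ) : ℝ :=
  sinPeriod α (2 * genPi α * Int.fract (y / (2 * genPi α)))

/-- `cos_α = (sin_α)'`. -/
def genCos (α : ℕ) : ℝ → ℝ := deriv (genSin α)

/-! ### The Grushin space, its vector fields, and its Hamiltonian

The exponents are `α : Fin n → ℕ`; points and covectors are elements of `Fin (n+1) → ℝ`. -/

variable {n : ℕ}

/-- `ξ_j(x) = ∏_{i<j} x_i^{α_i}`. -/
def xi (α : Fin n → ℕ) (j : Fin (n + 1)) (x : Fin (n + 1) → ℝ) : ℝ :=
  ∏ i : Fin n with i.castSucc < j, x i.castSucc ^ α i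

/-- The vector field `X_j = ξ_j ∂_{x_j}`. -/
def vectorField (α : Fin n → ℕ) (j : Fin (n + 1)) (x : Fin (n + 1) → ℝ) : Fin (n + 1) → ℝ :=
  Pi.single j (xi α j x)

/-- A point is Riemannian if the vector fields span the tangent space there. -/
def IsRiemannianPoint (α : Fin n → ℕ) (x : Fin (n + 1) → ℝ) : Prop :=
  Submodule.span ℝ (Set.range fun j => vectorField α j x) = ⊤

/-- `H(x,p) = ½ ∑_j ⟨p, X_j(x)⟩²`. -/
def hamiltonian (α : Fin n → ℕ) (x p : Fin (n + 1) → ℝ) : ℝ :=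
  (1 / 2) * ∑ j, (∑ i, p i * vectorField α j x i) ^ 2

/-- `t ↦ (x(t), p(t))` solves Hamilton's equations `x' = ∂H/∂p`, `p' = -∂H/∂x` on `ℝ`. -/
def IsExtremal (α : Fin n → ℕ) (x p : ℝ → Fin (n + 1) → ℝ) : Prop :=
  ∀ (t : ℝ) (j : Fin (n + 1)),
    HasDerivAt (fun s => x s j)
      (deriv (fun q => hamiltonian α (x t) (Function.update (p t) j q)) (p t j)) t ∧
    HasDerivAt (fun s => p s j)
      (-deriv (fun y => hamiltonian α (Function.update (x t) j y) (p t)) (x t j)) t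

open Classical in
/-- The geodesic `x(·; p⁰)` starting at `x⁰` with initial covector `p⁰`: the first component of
the (unique) solution of Hamilton's equations with initial data `(x⁰, p⁰)`. -/
def geodesic (α : Fin n → ℕ) (x₀ p₀ : Fin (n + 1) → ℝ) : ℝ → Fin (n + 1) → ℝ :=
  if h : ∃ x p, IsExtremal α x p ∧ x 0 = x₀ ∧ p 0 = p₀ then h.choose else fun _ => x₀

/-- The exponential map `exp_{x⁰}(p⁰) = x(1; p⁰)`. -/
def expMap (α : Fin n → ℕ) (x₀ p₀ : Fin (n + 1) → ℝ) : Fin (n + 1) → ℝ :=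
  geodesic α x₀ p₀ 1

/-- The exponential map at `x⁰` has a critical point at `v`. -/
def IsCriticalCovector (α : Fin n → ℕ) (x₀ v : Fin (n + 1) → ℝ) : Prop :=
  ¬ Function.Surjective (fderiv ℝ (expMap α x₀) v)

/-- The (first) conjugate time `inf {t > 0 : exp_{x⁰} has a critical point at t p⁰}` in
`[-∞, +∞]`, with `inf ∅ = +∞`. -/
def conjTime (α : Fin n → ℕ) (x₀ p₀ : Fin (n + 1) → ℝ) : EReal :=
  ⨅ (t : ℝ) (_ : 0 < t ∧ IsCriticalCovector α x₀ (t • p₀)), (t : EReal)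

/-! ### Generalized spherical coordinates -/

/-- `J = {j : α_j ≠ 0}`. -/
def J (α : Fin n → ℕ) : Finset (Fin n) := {j | α j ≠ 0}

/-- `α̃`, that is `α` with every zero entry replaced by `1`. -/
def tildeExp (α : Fin n → ℕ) (j : Fin n) : ℕ := if α j = 0 then 1 else α j

/-- `x⁰_j` for `j ∈ J`, and `1` for `j ∉ J`. -/
def tildePt (α : Fin n → ℕ) (x₀ : Fin (n + 1) → ℝ) (j : Fin n) : ℝ :=
  if α j = 0 then 1 else x₀ j.castSucc

/-- `ρ_θ(x) = |x|^{θ-1} x`, for `θ ≥ 1`. -/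
def rho (θ : ℕ) (x : ℝ) : ℝ := |x| ^ (θ - 1) * x

/-- `δ_j = ρ_{α_j}(sin_{α_j}(φ_j) / x⁰_j)` for `j ∈ J`, and `δ_j = sin_1(φ_j) = sin φ_j`
otherwise. -/
def delta (α : Fin n → ℕ) (x₀ : Fin (n + 1) → ℝ) (φ : Fin n → ℝ) (j : Fin n) : ℝ :=
  rho (tildeExp α j) (genSin (tildeExp α j) (φ j) / tildePt α x₀ j)

/-- The initial covector `p⁰(φ)`: `p⁰_j = cos_{α̃_j}(φ_j) ∏_{i<j} δ_i` for `j ≤ n`, and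
`p⁰_{n+1} = ∏_{i≤n} δ_i`. -/
def covector (α : Fin n → ℕ) (x₀ : Fin (n + 1) → ℝ) (φ : Fin n → ℝ) : Fin (n + 1) → ℝ :=
  Fin.snoc (α := fun _ => ℝ)
    (fun j : Fin n => genCos (tildeExp α j) (φ j) * ∏ i : Fin n with i < j, delta α x₀ φ i)
    (∏ i : Fin n, delta α x₀ φ i)

/-- The rectangle `∏_{j≤n-1} [0, π_{α̃_j}] × [0, 2π_{α̃_n})`. -/
def rectangle (α : Fin n → ℕ) : Set (Fin n → ℝ) :=
  {φ | ∀ j : Fin n,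
    (j.val + 1 < n → φ j ∈ Set.Icc 0 (genPi (tildeExp α j))) ∧
    (j.val + 1 = n → φ j ∈ Set.Ico 0 (2 * genPi (tildeExp α j)))}

/-- `R⁰_α`: the points of the rectangle with `sin_{α̃_j}(φ_j) ≠ 0` for all `j`. -/
def rectangle0 (α : Fin n → ℕ) : Set (Fin n → ℝ) :=
  {φ | φ ∈ rectangle α ∧ ∀ j : Fin n, genSin (tildeExp α j) (φ j) ≠ 0}

/-- `ω_j = (sin_{α_j}(φ_j) / x⁰_j) ∏_{i<j} δ_i`, used for `j ∈ J`. -/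
def omega (α : Fin n → ℕ) (x₀ : Fin (n + 1) → ℝ) (φ : Fin n → ℝ) (j : Fin n) : ℝ :=
  genSin (α j) (φ j) / x₀ j.castSucc * ∏ i : Fin n with i < j, delta α x₀ φ i

/-- The set `{t > 0 : |ω_j| ∫₀ᵗ ξ_j² ds = π_{α_j}}`, with `ξ_j` taken along the geodesic with
initial covector `p⁰(φ)`. -/
def tauSet (α : Fin n → ℕ) (x₀ : Fin (n + 1) → ℝ) (φ : Fin n → ℝ) (j : Fin n) : Set ℝ :=
  {t | 0 < t ∧
    |omega α x₀ φ j| *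
      (∫ s in (0 : ℝ)..t, xi α j.castSucc (geodesic α x₀ (covector α x₀ φ) s) ^ 2) = genPi (α j)}

/-- `τ_j = min {t > 0 : |ω_j| ∫₀ᵗ ξ_j² ds = π_{α_j}}`, used for `j ∈ J`. -/
def tauComp (α : Fin n → ℕ) (x₀ : Fin (n + 1) → ℝ) (φ : Fin n → ℝ) (j : Fin n) : ℝ :=
  sInf (tauSet α x₀ φ j)

/-- `τ = min_{j ∈ J} τ_j`, which is `+∞` if `J` is empty. -/
def tau (α : Fin n → ℕ) (x₀ : Fin (n + 1) → ℝ) (φ : Fin n → ℝ) : EReal :=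
  ⨅ j ∈ J α, (tauComp α x₀ φ j : EReal)

end

end Grushin

namespace Grushin

noncomputable section

open Set Filter Topology MeasureTheory

/-! ### Generalized trigonometric functions -/

section Trig

variable {m : ℕ}

/-! The Hamiltonian is a chain of one-dimensional oscillators. Put `h_{n+1} = p_{n+1}^2` and `h_k =
p_k^2 + h_{k+1} x_k^{2α_k}`. Each `h_k` is conserved, and `2H` depends on `x_k` only through `ξ_k^2
x_k^{2α_k} h_{k+1}`. Measured with its own clock `s_k = ∫ ξ_k^2 dt`, the coordinate `x_k` therefore
solves `x' = p`, `p' = -α_k h_{k+1} x^{2α_k-1}`, so it is a multiple of the generalized sine for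
`α_k ≠ 0` and affine for `α_k = 0`. The next clock is the integral of `x_k^{2α_k}` against `s_k`,
which has a closed form. On the rectangle considered, `p_{n+1} ≠ 0`, hence all `h_k > 0`. The
frequency of level `j` is `|ω_j|`, so `τ_j` is the time at which level `j` completes half a period.

A critical point of the exponential map is a nonzero variation of the covector that fixes the
endpoint to first order. At a single level, with energy `E`, coefficient `c`, duration `s` and
outgoing clock `K`, the action is `∫ p dx = E s - c K`. Hamilton-Jacobi theory with fixed endpoints
gives `2 c K' + K c' = 2 E s' + s E'` (`osc_balance`). Thus `2 h_k s_k' + s_k h_k' = 0` passes from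
level `n+1`, where it follows directly from the fixed last coordinate, to level 1. There the clock
is time itself, so `s_1' = 0` and hence `h_1' = 0`. Going back along the chain, once `s_k' = h_k' =
0`, the variations of amplitude and phase at a level with `α_k ≠ 0` satisfy two linear equations
with determinant `focal`. If it is nonzero, then `p_k' = h_{k+1}' = s_{k+1}' = 0` (`osc_rigid`); for
`α_k = 0` this is immediate. So the map is regular wherever no focal determinant vanishes
(`not_isCriticalCovector`).

From initial phase `ψ` in `(0, π_m)`, the determinant is positive on `(ψ, ψ + π_m)` (`focal_pos`)
and equals `π_m cos_m(ψ)^2` at `ψ + π_m`. Positivity gives `τ ≤ t_con`. If no level attaining `τ`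
starts at rest, all determinants are still nonzero at `τ` and, by continuity, slightly beyond, so `τ
< t_con`. If such a level does start at rest, varying only its initial momentum changes neither its
endpoint nor the next clock to first order (`osc_focus`), so `τ` is conjugate. Starting at rest
means `cos(φ_j) = 0`, i.e. `φ_j` is `π_{α_j}/2` or `3π_{α_j}/2`. -/

lemma one_sub_pow_pos (hm : m ≠ 0) {t : ℝ} (h0 : 0 ≤ t) (h1 : t < 1) : 0 < 1 - t ^ (2 * m) := by
  have := pow_lt_one₀ h0 h1 (n := 2 * m) (by omega)
  linarith

/-- The integrand is singular at 1. Since `t^(2m) ≤ t` on `[0,1]`, it is dominated by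
`(1-t)^(-1/2)`, which has the continuous primitive `-2√(1-t)`. -/
lemma intervalIntegrable_arcLen (hm : m ≠ 0) :
    IntervalIntegrable (fun t : ℝ => 1 / Real.sqrt (1 - t ^ (2 * m))) volume 0 1 := by
  have h1 : IntervalIntegrable (fun t : ℝ => 1 / Real.sqrt (1 - t)) volume 0 1 := by
    refine intervalIntegral.intervalIntegrable_deriv_of_nonneg
      (g := fun t => -(2 * Real.sqrt (1 - t))) ?_ ?_ ?_
    · fun_prop
    · intro x hx
      simp only [zero_le_one, min_eq_left, max_eq_right, mem_Ioo] at hx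
      have hs : Real.sqrt (1 - x) ≠ 0 := (Real.sqrt_pos.2 (by linarith [hx.2])).ne'
      have := (((hasDerivAt_id x).const_sub 1).sqrt (by simp; linarith [hx.2])).const_mul 2 |>.neg
      refine this.congr_deriv ?_
      simp only [id]
      field_simp
    · intro x _
      positivity
  refine h1.mono_fun' ?_ ?_
  · exact (Measurable.aestronglyMeasurable (by fun_prop))
  · rw [uIoc_of_le zero_le_one]
    refine (ae_restrict_iff' measurableSet_Ioc).2 (Eventually.of_forall fun t ht => ?_)
    simp only
    rw [Real.norm_of_nonneg (by positivity)]
    -- At `t = 1` both integrands are `1 / 0 = 0`.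
    rcases eq_or_lt_of_le ht.2 with rfl | h
    · simp
    · have hle : t ^ (2 * m) ≤ t := pow_le_of_le_one ht.1.le ht.2 (by omega)
      exact one_div_le_one_div_of_le (Real.sqrt_pos.2 (by linarith))
        (Real.sqrt_le_sqrt (by linarith))

/-- The integrand is at least 1. This one estimate yields strict monotonicity of `arcLen` and the
Lipschitz bound for its inverse. -/
lemma sub_le_arcLen_sub (hm : m ≠ 0) {x y : ℝ} (hx : 0 ≤ x) (hxy : x ≤ y) (hy : y ≤ 1) :
    y - x ≤ arcLen m y - arcLen m x := by
  have hI := intervalIntegrable_arcLen hm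
  have h1 : IntervalIntegrable (fun t : ℝ => 1 / Real.sqrt (1 - t ^ (2 * m))) volume 0 y :=
    hI.mono_set (by rw [uIcc_of_le (hx.trans hxy), uIcc_of_le zero_le_one]; exact Icc_subset_Icc le_rfl hy)
  have h2 : IntervalIntegrable (fun t : ℝ => 1 / Real.sqrt (1 - t ^ (2 * m))) volume 0 x :=
    hI.mono_set (by rw [uIcc_of_le hx, uIcc_of_le zero_le_one]; exact Icc_subset_Icc le_rfl (hxy.trans hy))
  rw [arcLen, arcLen, intervalIntegral.integral_interval_sub_left h1 h2]
  have h3 : (∫ _t in x..y, (1 : ℝ)) = y - x := by simp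
  rw [← h3]
  -- The comparison stays on the open interval because the integrand takes the value 0, not
  -- infinity, at `t = 1`.
  refine intervalIntegral.integral_mono_on_of_le_Ioo hxy (by simp) (h2.symm.trans h1) ?_
  intro t ht
  have hp := one_sub_pow_pos hm (hx.trans ht.1.le) (ht.2.trans_le hy)
  rw [le_div_iff₀ (Real.sqrt_pos.2 hp), one_mul]
  refine Real.sqrt_le_one.2 ?_
  have : 0 ≤ t ^ (2 * m) := pow_nonneg (hx.trans ht.1.le) _
  linarith

lemma arcLen_zero (m : ℕ) : arcLen m 0 = 0 := by simp [arcLen]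

lemma arcLen_one (m : ℕ) : arcLen m 1 = genPi m / 2 := by simp [genPi]

lemma genPi_pos (hm : m ≠ 0) : 0 < genPi m := by
  have := sub_le_arcLen_sub hm le_rfl zero_le_one le_rfl
  rw [arcLen_zero, arcLen_one] at this
  linarith

lemma arcLen_strictMonoOn (hm : m ≠ 0) : StrictMonoOn (arcLen m) (Icc 0 1) := by
  intro x hx y hy hxy
  have := sub_le_arcLen_sub hm hx.1 hxy.le hy.2
  linarith

lemma arcLen_mapsTo (hm : m ≠ 0) : MapsTo (arcLen m) (Icc 0 1) (Icc 0 (genPi m / 2)) := by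
  intro x hx
  rw [← arcLen_zero m, ← arcLen_one m]
  exact ⟨(arcLen_strictMonoOn hm).monotoneOn ⟨le_rfl, zero_le_one⟩ hx hx.1,
    (arcLen_strictMonoOn hm).monotoneOn hx ⟨zero_le_one, le_rfl⟩ hx.2⟩

lemma arcLen_surjOn (hm : m ≠ 0) : SurjOn (arcLen m) (Icc 0 1) (Icc 0 (genPi m / 2)) := by
  have hc : ContinuousOn (arcLen m) (Icc 0 1) := by
    have := intervalIntegral.continuousOn_primitive_interval' (intervalIntegrable_arcLen hm)
      (left_mem_uIcc)
    rwa [uIcc_of_le zero_le_one] at this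
  have := intermediate_value_Icc zero_le_one hc
  rwa [arcLen_zero, arcLen_one] at this

lemma hasDerivAt_arcLen (hm : m ≠ 0) {x : ℝ} (hx : x ∈ Ioo (0 : ℝ) 1) :
    HasDerivAt (arcLen m) (1 / Real.sqrt (1 - x ^ (2 * m))) x := by
  refine intervalIntegral.integral_hasDerivAt_right ?_ ?_ ?_
  · refine (intervalIntegrable_arcLen hm).mono_set ?_
    rw [uIcc_of_le hx.1.le, uIcc_of_le zero_le_one]
    exact Icc_subset_Icc le_rfl hx.2.le
  · exact (Measurable.stronglyMeasurable (by fun_prop)).stronglyMeasurableAtFilter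
  · have : Real.sqrt (1 - x ^ (2 * m)) ≠ 0 :=
      (Real.sqrt_pos.2 (one_sub_pow_pos hm hx.1.le hx.2)).ne'
    fun_prop (disch := assumption)

lemma sinQuarter_mem (hm : m ≠ 0) {y : ℝ} (hy : y ∈ Icc 0 (genPi m / 2)) :
    sinQuarter m y ∈ Icc (0 : ℝ) 1 :=
  Function.invFunOn_mem (arcLen_surjOn hm hy)

lemma arcLen_sinQuarter (hm : m ≠ 0) {y : ℝ} (hy : y ∈ Icc 0 (genPi m / 2)) :
    arcLen m (sinQuarter m y) = y :=
  Function.invFunOn_eq (arcLen_surjOn hm hy)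

lemma sinQuarter_arcLen (hm : m ≠ 0) {x : ℝ} (hx : x ∈ Icc (0 : ℝ) 1) :
    sinQuarter m (arcLen m x) = x :=
  (arcLen_strictMonoOn hm).injOn (sinQuarter_mem hm (arcLen_mapsTo hm hx)) hx
    (arcLen_sinQuarter hm (arcLen_mapsTo hm hx))

lemma sinQuarter_zero (hm : m ≠ 0) : sinQuarter m 0 = 0 := by
  conv_lhs => rw [← arcLen_zero m]
  exact sinQuarter_arcLen hm ⟨le_rfl, zero_le_one⟩

lemma sinQuarter_half (hm : m ≠ 0) : sinQuarter m (genPi m / 2) = 1 := by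
  rw [← arcLen_one m]
  exact sinQuarter_arcLen hm ⟨zero_le_one, le_rfl⟩

lemma sinQuarter_mem_Ioo (hm : m ≠ 0) {y : ℝ} (hy : y ∈ Ioo 0 (genPi m / 2)) :
    sinQuarter m y ∈ Ioo (0 : ℝ) 1 := by
  have h := sinQuarter_mem hm (Ioo_subset_Icc_self hy)
  have he := arcLen_sinQuarter hm (Ioo_subset_Icc_self hy)
  refine ⟨lt_of_le_of_ne h.1 fun h0 => ?_, lt_of_le_of_ne h.2 fun h1 => ?_⟩
  · rw [← h0, arcLen_zero] at he
    exact hy.1.ne he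
  · rw [h1, arcLen_one] at he
    exact hy.2.ne he.symm

/-- `arcLen` does not contract distances, so its inverse is 1-Lipschitz. -/
lemma sinQuarter_continuousOn (hm : m ≠ 0) :
    ContinuousOn (sinQuarter m) (Icc 0 (genPi m / 2)) := by
  have key : ∀ x ∈ Icc 0 (genPi m / 2), ∀ y ∈ Icc 0 (genPi m / 2),
      |sinQuarter m x - sinQuarter m y| ≤ |x - y| := by
    have : ∀ x ∈ Icc 0 (genPi m / 2), ∀ y ∈ Icc 0 (genPi m / 2),
        sinQuarter m x - sinQuarter m y ≤ |x - y| := by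
      intro x hx y hy
      rcases le_total (sinQuarter m y) (sinQuarter m x) with h | h
      · have := sub_le_arcLen_sub hm (sinQuarter_mem hm hy).1 h (sinQuarter_mem hm hx).2
        rw [arcLen_sinQuarter hm hx, arcLen_sinQuarter hm hy] at this
        exact this.trans (le_abs_self _)
      · exact (sub_nonpos.2 h).trans (abs_nonneg _)
    intro x hx y hy
    refine abs_le.2 ⟨?_, this x hx y hy⟩
    have := this y hy x hx
    rw [abs_sub_comm] at this
    linarith
  refine (LipschitzOnWith.of_dist_le_mul (K := 1) fun x hx y hy => ?_).continuousOn
  simpa [Real.dist_eq] using key x hx y hy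

lemma hasDerivAt_sinQuarter (hm : m ≠ 0) {y : ℝ} (hy : y ∈ Ioo 0 (genPi m / 2)) :
    HasDerivAt (sinQuarter m) (Real.sqrt (1 - sinQuarter m y ^ (2 * m))) y := by
  have hs := sinQuarter_mem_Ioo hm hy
  have h := hasDerivAt_arcLen hm hs
  have hnz : Real.sqrt (1 - sinQuarter m y ^ (2 * m)) ≠ 0 :=
    (Real.sqrt_pos.2 (one_sub_pow_pos hm hs.1.le hs.2)).ne'
  have hc : ContinuousAt (sinQuarter m) y :=
    (sinQuarter_continuousOn hm).continuousAt (Icc_mem_nhds hy.1 hy.2)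
  have := HasDerivAt.of_local_left_inverse hc h (by simpa using hnz) ?_
  · simpa using this
  · filter_upwards [Ioo_mem_nhds hy.1 hy.2] with z hz
    exact arcLen_sinQuarter hm (Ioo_subset_Icc_self hz)

/-- The inverse function rule covers only the open interval. The one-sided derivatives at its
endpoints are obtained as limits of the interior derivative. -/
lemma tendsto_deriv_sinQuarter (hm : m ≠ 0) {a : ℝ} (ha : a ∈ Icc 0 (genPi m / 2)) :
    Tendsto (deriv (sinQuarter m)) (𝓝[Ioo 0 (genPi m / 2)] a)
      (𝓝 (Real.sqrt (1 - sinQuarter m a ^ (2 * m)))) := by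
  have hc : ContinuousWithinAt (fun y => Real.sqrt (1 - sinQuarter m y ^ (2 * m)))
      (Ioo 0 (genPi m / 2)) a :=
    (((sinQuarter_continuousOn hm a ha).mono Ioo_subset_Icc_self).pow _).const_sub 1 |>.sqrt
  refine hc.tendsto.congr' ?_
  filter_upwards [self_mem_nhdsWithin] with y hy
  exact (hasDerivAt_sinQuarter hm hy).deriv.symm

lemma hasDerivWithinAt_sinQuarter_zero (hm : m ≠ 0) :
    HasDerivWithinAt (sinQuarter m) 1 (Ici 0) 0 := by
  have hpi := genPi_pos hm
  have h0 : (0 : ℝ) ∈ Icc 0 (genPi m / 2) := ⟨le_rfl, by linarith⟩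
  refine hasDerivWithinAt_Ici_of_tendsto_deriv (s := Ioo 0 (genPi m / 2)) ?_ ?_ ?_ ?_
  · exact fun y hy => (hasDerivAt_sinQuarter hm hy).differentiableAt.differentiableWithinAt
  · exact (sinQuarter_continuousOn hm 0 h0).mono Ioo_subset_Icc_self
  · exact Ioo_mem_nhdsGT (by linarith)
  · have := tendsto_deriv_sinQuarter hm h0
    rw [nhdsWithin_Ioo_eq_nhdsGT (by linarith)] at this
    simpa [sinQuarter_zero hm, hm] using this

lemma hasDerivWithinAt_sinQuarter_half (hm : m ≠ 0) :
    HasDerivWithinAt (sinQuarter m) 0 (Iic (genPi m / 2)) (genPi m / 2) := by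
  have hpi := genPi_pos hm
  have h0 : genPi m / 2 ∈ Icc 0 (genPi m / 2) := ⟨by linarith, le_rfl⟩
  refine hasDerivWithinAt_Iic_of_tendsto_deriv (s := Ioo 0 (genPi m / 2)) ?_ ?_ ?_ ?_
  · exact fun y hy => (hasDerivAt_sinQuarter hm hy).differentiableAt.differentiableWithinAt
  · exact (sinQuarter_continuousOn hm _ h0).mono Ioo_subset_Icc_self
  · exact Ioo_mem_nhdsLT (by linarith)
  · have := tendsto_deriv_sinQuarter hm h0
    rw [nhdsWithin_Ioo_eq_nhdsLT (by linarith)] at this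
    simpa [sinQuarter_half hm] using this

/-! ### Symmetries and differentiability of the generalized sine and cosine -/

lemma genSin_periodic (hm : m ≠ 0) : Function.Periodic (genSin m) (2 * genPi m) := by
  intro y
  have hpi := genPi_pos hm
  rw [genSin, genSin, add_div, div_self (by positivity), Int.fract_add_one]

lemma genSin_of_mem (hm : m ≠ 0) {y : ℝ} (hy : y ∈ Ico 0 (2 * genPi m)) :
    genSin m y = sinPeriod m y := by
  have hpi := genPi_pos hm
  have h2 : 0 < 2 * genPi m := by positivity
  rw [genSin, Int.fract_eq_self.2 ⟨div_nonneg hy.1 h2.le, (div_lt_one h2).2 hy.2⟩]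
  congr 1
  field_simp

lemma genSin_antiperiodic (hm : m ≠ 0) : Function.Antiperiodic (genSin m) (genPi m) := by
  have hpi := genPi_pos hm
  have key : ∀ y ∈ Ico 0 (genPi m), genSin m (y + genPi m) = -genSin m y := by
    intro y hy
    rw [genSin_of_mem hm ⟨hy.1, by linarith [hy.2]⟩,
      genSin_of_mem hm ⟨by linarith [hy.1], by linarith [hy.2]⟩, sinPeriod, sinPeriod]
    have h3 : ¬ (y + genPi m ≤ genPi m / 2) := by linarith [hy.1]
    rw [if_neg h3]
    -- For `y = 0` the shifted point `π_m` falls in the second branch of `sinPeriod`, not in the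
    -- third.
    by_cases h0 : y = 0
    · subst h0
      rw [if_pos (by linarith), if_pos (by linarith)]
      simp [sinQuarter_zero hm]
    have h0' : 0 < y := lt_of_le_of_ne hy.1 (Ne.symm h0)
    rw [if_neg (by linarith)]
    by_cases h : y ≤ genPi m / 2
    · rw [if_pos (by linarith), if_pos h]
      simp
    · rw [if_neg (by linarith), if_neg h, if_pos hy.2.le]
      congr 2
      ring
  -- The identity to be proved is itself a `2π_m`-periodic proposition in `y`, so checking it on one
  -- period suffices.
  have hP : Function.Periodic (fun y => genSin m (y + genPi m) = -genSin m y) (2 * genPi m) := by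
    intro y
    simp only [eq_iff_iff]
    rw [genSin_periodic hm y, show y + 2 * genPi m + genPi m = y + genPi m + 2 * genPi m by ring,
      genSin_periodic hm]
  intro y
  obtain ⟨z, hz, hyz⟩ := hP.exists_mem_Ico₀ (by positivity) y
  refine hyz.mpr ?_
  by_cases h : z < genPi m
  · exact key z ⟨hz.1, h⟩
  · have := key (z - genPi m) ⟨by linarith, by linarith [hz.2]⟩
    rw [sub_add_cancel] at this
    rw [this, neg_neg, ← genSin_periodic hm (z - genPi m)]
    congr 1
    ring

lemma genSin_eq_sinQuarter (hm : m ≠ 0) {y : ℝ} (hy : y ∈ Icc 0 (genPi m / 2)) :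
    genSin m y = sinQuarter m y := by
  have hpi := genPi_pos hm
  rw [genSin_of_mem hm ⟨hy.1, by linarith [hy.2]⟩, sinPeriod, if_pos hy.2]

lemma genSin_pi_sub_of_mem (hm : m ≠ 0) {y : ℝ} (hy : y ∈ Icc 0 (genPi m)) :
    genSin m (genPi m - y) = genSin m y := by
  have hpi := genPi_pos hm
  rw [genSin_of_mem hm ⟨hy.1, by linarith [hy.2]⟩,
    genSin_of_mem hm ⟨by linarith [hy.2], by linarith [hy.1]⟩, sinPeriod, sinPeriod]
  by_cases h : y ≤ genPi m / 2
  · rw [if_pos h]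
    by_cases h' : y = genPi m / 2
    · rw [if_pos (by linarith)]
      congr 1
      linarith
    · have : y < genPi m / 2 := lt_of_le_of_ne h h'
      rw [if_neg (by linarith), if_pos (by linarith [hy.1])]
      congr 1
      ring
  · rw [if_pos (by linarith), if_neg h, if_pos hy.2]

lemma genSin_neg (hm : m ≠ 0) (y : ℝ) : genSin m (-y) = -genSin m y := by
  have hpi := genPi_pos hm
  have hA := genSin_antiperiodic hm
  have hP : Function.Periodic (fun y => genSin m (-y) = -genSin m y) (genPi m) := by
    intro y
    simp only
    have h1 : genSin m (-(y + genPi m)) = -genSin m (-y) := by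
      have := hA (-(y + genPi m))
      rw [show -(y + genPi m) + genPi m = -y by ring] at this
      rw [this, neg_neg]
    rw [h1, hA y]
    simp [neg_eq_iff_eq_neg]
  obtain ⟨z, hz, hyz⟩ := hP.exists_mem_Ico₀ hpi y
  refine hyz.mpr ?_
  have h1 := hA (-z)
  rw [show -z + genPi m = genPi m - z by ring, genSin_pi_sub_of_mem hm ⟨hz.1, hz.2.le⟩] at h1
  rw [h1, neg_neg]

lemma genSin_pi_sub (hm : m ≠ 0) (y : ℝ) : genSin m (genPi m - y) = genSin m y := by
  rw [show genPi m - y = -y + genPi m by ring, genSin_antiperiodic hm, genSin_neg hm, neg_neg]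

lemma genSin_zero (hm : m ≠ 0) : genSin m 0 = 0 := by
  have := genPi_pos hm
  rw [genSin_eq_sinQuarter hm ⟨le_rfl, by linarith⟩, sinQuarter_zero hm]

lemma genSin_half (hm : m ≠ 0) : genSin m (genPi m / 2) = 1 := by
  have := genPi_pos hm
  rw [genSin_eq_sinQuarter hm ⟨by linarith, le_rfl⟩, sinQuarter_half hm]

/-- Oddness transfers the derivative to negative arguments. At 0 the two one-sided derivatives are
glued. -/
lemma hasDerivAt_genSin_of_mem (hm : m ≠ 0) {y : ℝ}
    (hy : y ∈ Ioo (-(genPi m / 2)) (genPi m / 2)) :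
    HasDerivAt (genSin m) (Real.sqrt (1 - genSin m y ^ (2 * m))) y := by
  have hpi := genPi_pos hm
  have pos : ∀ z ∈ Ioo 0 (genPi m / 2),
      HasDerivAt (genSin m) (Real.sqrt (1 - genSin m z ^ (2 * m))) z := by
    intro z hz
    rw [genSin_eq_sinQuarter hm (Ioo_subset_Icc_self hz)]
    refine (hasDerivAt_sinQuarter hm hz).congr_of_eventuallyEq ?_
    filter_upwards [Ioo_mem_nhds hz.1 hz.2] with w hw
    exact genSin_eq_sinQuarter hm (Ioo_subset_Icc_self hw)
  have hfun : (fun z => -genSin m (-z)) = genSin m := by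
    ext z
    rw [genSin_neg hm, neg_neg]
  rcases lt_trichotomy y 0 with h | rfl | h
  · have := ((pos (-y) ⟨by linarith, by linarith [hy.1]⟩).comp y (hasDerivAt_neg y)).neg
    rw [genSin_neg hm, (even_two_mul m).neg_pow] at this
    have h3 : -genSin m ∘ Neg.neg = genSin m := hfun
    rw [h3] at this
    simpa using this
  · have hr : HasDerivWithinAt (genSin m) 1 (Ici 0) 0 := by
      refine (hasDerivWithinAt_sinQuarter_zero hm).congr_of_eventuallyEq ?_ ?_
      · filter_upwards [Icc_mem_nhdsGE (show (0 : ℝ) < genPi m / 2 by linarith)] with w hw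
        exact genSin_eq_sinQuarter hm hw
      · exact genSin_eq_sinQuarter hm ⟨le_rfl, by linarith⟩
    have hl : HasDerivWithinAt (genSin m) 1 (Iic 0) 0 := by
      have h1 : HasDerivWithinAt (genSin m) 1 (Ici 0) (-(0 : ℝ)) := by simpa using hr
      have h2 := (h1.comp (0 : ℝ) ((hasDerivAt_neg (0 : ℝ)).hasDerivWithinAt (s := Iic 0))
        (fun z hz => by simpa using hz)).neg
      have h3 : -(genSin m ∘ Neg.neg) = genSin m := hfun
      rw [h3] at h2
      simpa using h2
    have h4 := hl.union hr
    rw [Iic_union_Ici, hasDerivWithinAt_univ] at h4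
    simpa [genSin_zero hm, hm] using h4
  · exact pos y ⟨h, hy.2⟩

lemma hasDerivAt_genSin_half (hm : m ≠ 0) : HasDerivAt (genSin m) 0 (genPi m / 2) := by
  have hpi := genPi_pos hm
  have hl : HasDerivWithinAt (genSin m) 0 (Iic (genPi m / 2)) (genPi m / 2) := by
    refine (hasDerivWithinAt_sinQuarter_half hm).congr_of_eventuallyEq ?_ ?_
    · filter_upwards [Icc_mem_nhdsLE (show (0 : ℝ) < genPi m / 2 by linarith)] with w hw
      exact genSin_eq_sinQuarter hm hw
    · exact genSin_eq_sinQuarter hm ⟨by linarith, le_rfl⟩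
  have hr : HasDerivWithinAt (genSin m) 0 (Ici (genPi m / 2)) (genPi m / 2) := by
    have h1 : HasDerivWithinAt (genSin m) 0 (Iic (genPi m / 2)) (genPi m - genPi m / 2) := by
      rwa [show genPi m - genPi m / 2 = genPi m / 2 by ring]
    have h2 := h1.comp (genPi m / 2)
      (((hasDerivAt_id' (genPi m / 2)).const_sub (genPi m)).hasDerivWithinAt
        (s := Ici (genPi m / 2)))
      (fun z hz => by simp only [mem_Ici, mem_Iic] at *; linarith)
    have h3 : (genSin m ∘ fun x => genPi m - x) = genSin m := by
      ext z
      exact genSin_pi_sub hm z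
    rw [h3] at h2
    simpa using h2
  have h4 := hl.union hr
  rwa [Iic_union_Ici, hasDerivWithinAt_univ] at h4

lemma genCos_of_mem (hm : m ≠ 0) {y : ℝ} (hy : y ∈ Ioo (-(genPi m / 2)) (genPi m / 2)) :
    genCos m y = Real.sqrt (1 - genSin m y ^ (2 * m)) :=
  (hasDerivAt_genSin_of_mem hm hy).deriv

lemma genCos_half (hm : m ≠ 0) : genCos m (genPi m / 2) = 0 :=
  (hasDerivAt_genSin_half hm).deriv

lemma genCos_zero (hm : m ≠ 0) : genCos m 0 = 1 := by
  have := genPi_pos hm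
  rw [genCos_of_mem hm ⟨by linarith, by linarith⟩, genSin_zero hm]
  simp [hm]

lemma genCos_antiperiodic (hm : m ≠ 0) : Function.Antiperiodic (genCos m) (genPi m) := by
  intro y
  have h : (fun z => genSin m (z + genPi m)) = fun z => -genSin m z := by
    ext z
    exact genSin_antiperiodic hm z
  have h1 := deriv_comp_add_const (genSin m) (genPi m) y
  rw [h] at h1
  rw [genCos, ← h1]
  simp

lemma genCos_neg (hm : m ≠ 0) (y : ℝ) : genCos m (-y) = genCos m y := by
  have h : (fun z => genSin m (-z)) = fun z => -genSin m z := by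
    ext z
    exact genSin_neg hm z
  have h1 := deriv_comp_neg (genSin m) y
  rw [h] at h1
  simp only [deriv.fun_neg, neg_inj] at h1
  rw [genCos, h1]

lemma genCos_pi_sub (hm : m ≠ 0) (y : ℝ) : genCos m (genPi m - y) = -genCos m y := by
  rw [show genPi m - y = -y + genPi m by ring, genCos_antiperiodic hm, genCos_neg hm]

lemma abs_genSin_lt_one (hm : m ≠ 0) {y : ℝ} (hy : y ∈ Ioo (-(genPi m / 2)) (genPi m / 2)) :
    |genSin m y| < 1 := by
  have hpi := genPi_pos hm
  have key : ∀ z ∈ Ico 0 (genPi m / 2), |genSin m z| < 1 := by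
    intro z hz
    rcases eq_or_lt_of_le hz.1 with rfl | h
    · simp [genSin_zero hm]
    · have := sinQuarter_mem_Ioo hm ⟨h, hz.2⟩
      rw [genSin_eq_sinQuarter hm ⟨hz.1, hz.2.le⟩, abs_of_pos this.1]
      exact this.2
  rcases le_total 0 y with h | h
  · exact key y ⟨h, hy.2⟩
  · have := key (-y) ⟨by linarith, by linarith [hy.1]⟩
    rwa [genSin_neg hm, abs_neg] at this

lemma one_sub_genSin_pow_pos (hm : m ≠ 0) {y : ℝ}
    (hy : y ∈ Ioo (-(genPi m / 2)) (genPi m / 2)) : 0 < 1 - genSin m y ^ (2 * m) := by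
  have := one_sub_pow_pos hm (abs_nonneg _) (abs_genSin_lt_one hm hy)
  rwa [(even_two_mul m).pow_abs] at this

/-- A property invariant under translation by `π_m` holds everywhere once it holds on
`(-π_m/2, π_m/2]`. -/
lemma forall_of_periodic (hm : m ≠ 0) {P : ℝ → Prop} (hP : ∀ y, P (y + genPi m) = P y)
    (h1 : ∀ y ∈ Ioo (-(genPi m / 2)) (genPi m / 2), P y) (h2 : P (genPi m / 2)) (y : ℝ) : P y := by
  obtain ⟨z, hz, hyz⟩ := Function.Periodic.exists_mem_Ioc (f := P) (c := genPi m) hP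
    (genPi_pos hm) y (-(genPi m / 2))
  rw [hyz]
  rcases eq_or_lt_of_le hz.2 with h | h
  · rw [h, show -(genPi m / 2) + genPi m = genPi m / 2 by ring]
    exact h2
  · exact h1 z ⟨hz.1, by linarith⟩

lemma genCos_sq_add (hm : m ≠ 0) (y : ℝ) : genCos m y ^ 2 + genSin m y ^ (2 * m) = 1 := by
  refine forall_of_periodic hm (P := fun y => genCos m y ^ 2 + genSin m y ^ (2 * m) = 1)
    ?_ ?_ ?_ y
  · intro z
    rw [genCos_antiperiodic hm, genSin_antiperiodic hm, (even_two_mul m).neg_pow, neg_sq]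
  · intro z hz
    rw [genCos_of_mem hm hz, Real.sq_sqrt (one_sub_genSin_pow_pos hm hz).le]
    ring
  · simp [genCos_half hm, genSin_half hm]

lemma hasDerivAt_genSin (hm : m ≠ 0) (y : ℝ) : HasDerivAt (genSin m) (genCos m y) y := by
  refine DifferentiableAt.hasDerivAt (f := genSin m) ?_
  refine forall_of_periodic hm (P := fun y => DifferentiableAt ℝ (genSin m) y) ?_ ?_ ?_ y
  · intro z
    have h : (fun w => genSin m (w + genPi m)) = -genSin m := by
      ext w
      exact genSin_antiperiodic hm w
    rw [← differentiableAt_comp_add_const, h, differentiableAt_neg_iff]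
  · exact fun z hz => (hasDerivAt_genSin_of_mem hm hz).differentiableAt
  · exact (hasDerivAt_genSin_half hm).differentiableAt

lemma genSin_continuous (hm : m ≠ 0) : Continuous (genSin m) :=
  continuous_iff_continuousAt.2 fun y => (hasDerivAt_genSin hm y).continuousAt

lemma hasDerivAt_genCos_of_mem (hm : m ≠ 0) {y : ℝ}
    (hy : y ∈ Ioo (-(genPi m / 2)) (genPi m / 2)) :
    HasDerivAt (genCos m) (-(m * genSin m y ^ (2 * m - 1))) y := by
  have hp := one_sub_genSin_pow_pos hm hy
  have h := (((hasDerivAt_genSin_of_mem hm hy).pow (2 * m)).const_sub 1).sqrt hp.ne'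
  have hs : Real.sqrt (1 - genSin m y ^ (2 * m)) ≠ 0 := (Real.sqrt_pos.2 hp).ne'
  refine (h.congr_deriv ?_).congr_of_eventuallyEq ?_
  · simp only [Pi.pow_apply]
    push_cast
    field_simp
  · filter_upwards [Ioo_mem_nhds hy.1 hy.2] with z hz
    exact genCos_of_mem hm hz

/-- The chain rule for `√(1 - sin^(2m))` breaks down here because the radicand vanishes. The left
derivative is the limit of interior derivatives, and the reflection `y ↦ π_m - y` gives the right
one. -/
lemma hasDerivAt_genCos_half (hm : m ≠ 0) : HasDerivAt (genCos m) (-m) (genPi m / 2) := by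
  have hpi := genPi_pos hm
  have hl : HasDerivWithinAt (genCos m) (-m) (Iic (genPi m / 2)) (genPi m / 2) := by
    refine hasDerivWithinAt_Iic_of_tendsto_deriv
      (s := Ioo (-(genPi m / 2)) (genPi m / 2)) ?_ ?_ ?_ ?_
    · exact fun y hy => (hasDerivAt_genCos_of_mem hm hy).differentiableAt.differentiableWithinAt
    · have hc : ContinuousWithinAt (fun y => Real.sqrt (1 - genSin m y ^ (2 * m)))
          (Ioo (-(genPi m / 2)) (genPi m / 2)) (genPi m / 2) :=
        ((continuous_const.sub ((genSin_continuous hm).pow _)).sqrt).continuousWithinAt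
      refine hc.congr (fun y hy => genCos_of_mem hm hy) ?_
      simp [genCos_half hm, genSin_half hm]
    · exact Ioo_mem_nhdsLT (by linarith)
    · have hc : Tendsto (fun y => -(m * genSin m y ^ (2 * m - 1) : ℝ)) (𝓝[<] (genPi m / 2))
          (𝓝 (-(m * genSin m (genPi m / 2) ^ (2 * m - 1)))) :=
        (((genSin_continuous hm).pow _).const_mul _).neg.continuousAt.mono_left nhdsWithin_le_nhds
      rw [genSin_half hm, one_pow, mul_one] at hc
      refine hc.congr' ?_
      filter_upwards [Ioo_mem_nhdsLT (show -(genPi m / 2) < genPi m / 2 by linarith)] with y hy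
      exact (hasDerivAt_genCos_of_mem hm hy).deriv.symm
  have hr : HasDerivWithinAt (genCos m) (-m) (Ici (genPi m / 2)) (genPi m / 2) := by
    have h1 : HasDerivWithinAt (genCos m) (-m) (Iic (genPi m / 2)) (genPi m - genPi m / 2) := by
      rwa [show genPi m - genPi m / 2 = genPi m / 2 by ring]
    have h2 := (h1.comp (genPi m / 2)
      (((hasDerivAt_id' (genPi m / 2)).const_sub (genPi m)).hasDerivWithinAt
        (s := Ici (genPi m / 2)))
      (fun z hz => by simp only [mem_Ici, mem_Iic] at *; linarith)).neg
    have h3 : (-genCos m ∘ fun x => genPi m - x) = genCos m := by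
      ext z
      simp [genCos_pi_sub hm z]
    rw [h3] at h2
    simpa using h2
  have h4 := hl.union hr
  rwa [Iic_union_Ici, hasDerivWithinAt_univ] at h4

lemma hasDerivAt_genCos (hm : m ≠ 0) (y : ℝ) :
    HasDerivAt (genCos m) (-(m * genSin m y ^ (2 * m - 1))) y := by
  refine forall_of_periodic hm
    (P := fun y => HasDerivAt (genCos m) (-(m * genSin m y ^ (2 * m - 1))) y) ?_ ?_ ?_ y
  · intro z
    have h : (fun w => genCos m (w + genPi m)) = -genCos m := by
      ext w
      exact genCos_antiperiodic hm w
    have hodd : Odd (2 * m - 1) := ⟨m - 1, by omega⟩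
    have h' : (fun w => genCos m (w - genPi m)) = -genCos m := by
      ext w
      exact (genCos_antiperiodic hm).sub_eq w
    rw [eq_iff_iff, genSin_antiperiodic hm, hodd.neg_pow]
    constructor
    · intro h3
      have h4 := h3.comp_add_const z (genPi m)
      rw [h] at h4
      simpa using h4.neg
    · intro h3
      have h4 := HasDerivAt.comp_sub_const (z + genPi m) (genPi m)
        (by rwa [add_sub_cancel_right] : HasDerivAt (genCos m) _ (z + genPi m - genPi m))
      rw [h'] at h4
      simpa using h4.neg
  · exact fun z hz => hasDerivAt_genCos_of_mem hm hz
  · simpa [genSin_half hm] using hasDerivAt_genCos_half hm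

end Trig

/-! ### Signs, monotonicity and zeros of the generalized trigonometric functions -/

section TrigExtra

variable {m : ℕ}

lemma genSin_add_pi (hm : m ≠ 0) (y : ℝ) : genSin m (y + genPi m) = -genSin m y :=
  genSin_antiperiodic hm y

lemma genCos_add_pi (hm : m ≠ 0) (y : ℝ) : genCos m (y + genPi m) = -genCos m y :=
  genCos_antiperiodic hm y

lemma genCos_pi (hm : m ≠ 0) : genCos m (genPi m) = -1 := by
  have := genCos_add_pi hm 0
  rwa [zero_add, genCos_zero hm] at this

lemma genSin_pos (hm : m ≠ 0) {y : ℝ} (hy : y ∈ Ioo 0 (genPi m)) : 0 < genSin m y := by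
  have key : ∀ z ∈ Ioc 0 (genPi m / 2), 0 < genSin m z := by
    intro z hz
    rcases eq_or_lt_of_le hz.2 with rfl | h
    · simp [genSin_half hm]
    · rw [genSin_eq_sinQuarter hm ⟨hz.1.le, hz.2⟩]
      exact (sinQuarter_mem_Ioo hm ⟨hz.1, h⟩).1
  by_cases h : y ≤ genPi m / 2
  · exact key y ⟨hy.1, h⟩
  · rw [← genSin_pi_sub hm]
    exact key _ ⟨by linarith [hy.2], by linarith⟩

lemma genSin_nonneg (hm : m ≠ 0) {y : ℝ} (hy : y ∈ Icc 0 (genPi m)) : 0 ≤ genSin m y := by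
  rcases eq_or_lt_of_le hy.1 with rfl | h
  · exact (genSin_zero hm).ge
  rcases eq_or_lt_of_le hy.2 with rfl | h'
  · have := genSin_add_pi hm 0
    rw [zero_add, genSin_zero hm, neg_zero] at this
    exact this.ge
  exact (genSin_pos hm ⟨h, h'⟩).le

lemma genSin_neg_of_mem (hm : m ≠ 0) {y : ℝ} (hy : y ∈ Ioo (genPi m) (2 * genPi m)) :
    genSin m y < 0 := by
  have h := genSin_add_pi hm (y - genPi m)
  rw [sub_add_cancel] at h
  rw [h, neg_lt_zero]
  exact genSin_pos hm ⟨by linarith [hy.1], by linarith [hy.2]⟩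

lemma genCos_continuous (hm : m ≠ 0) : Continuous (genCos m) :=
  continuous_iff_continuousAt.2 fun y => (hasDerivAt_genCos hm y).continuousAt

lemma genCos_strictAntiOn (hm : m ≠ 0) : StrictAntiOn (genCos m) (Icc 0 (genPi m)) := by
  refine strictAntiOn_of_deriv_neg (convex_Icc _ _) (genCos_continuous hm).continuousOn ?_
  intro y hy
  rw [interior_Icc] at hy
  rw [(hasDerivAt_genCos hm y).deriv, neg_lt_zero]
  have := genSin_pos hm hy
  positivity

lemma abs_genSin_le_one (hm : m ≠ 0) (y : ℝ) : |genSin m y| ≤ 1 := by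
  by_contra h
  push Not at h
  have h1 := genCos_sq_add hm y
  have h2 := one_lt_pow₀ h (n := 2 * m) (by omega)
  rw [(even_two_mul m).pow_abs] at h2
  nlinarith [sq_nonneg (genCos m y)]

lemma abs_genCos_le_one (hm : m ≠ 0) (y : ℝ) : |genCos m y| ≤ 1 := by
  rw [← sq_le_one_iff_abs_le_one]
  have h1 := genCos_sq_add hm y
  have h2 : 0 ≤ genSin m y ^ (2 * m) := (even_two_mul m).pow_nonneg _
  linarith

lemma genCos_eq_zero_iff (hm : m ≠ 0) {y : ℝ} (hy : y ∈ Ico 0 (2 * genPi m)) :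
    genCos m y = 0 ↔ y = genPi m / 2 ∨ y = 3 * genPi m / 2 := by
  have hpi := genPi_pos hm
  have key : ∀ z ∈ Icc 0 (genPi m), genCos m z = 0 → z = genPi m / 2 := fun z hz h =>
    (genCos_strictAntiOn hm).injOn hz ⟨by linarith, by linarith⟩ (h.trans (genCos_half hm).symm)
  have h3 : genCos m (3 * genPi m / 2) = 0 := by
    have := genCos_add_pi hm (genPi m / 2)
    rw [genCos_half hm, neg_zero] at this
    rw [← this]
    congr 1
    ring
  constructor
  · intro h
    by_cases h' : y ≤ genPi m
    · exact Or.inl (key y ⟨hy.1, h'⟩ h)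
    · right
      have h1 := genCos_add_pi hm (y - genPi m)
      rw [sub_add_cancel, h, eq_comm, neg_eq_zero] at h1
      have := key (y - genPi m) ⟨by linarith, by linarith [hy.2]⟩ h1
      linarith
  · rintro (rfl | rfl)
    · exact genCos_half hm
    · exact h3

/-! ### The inverse of the generalized cosine -/

/-- The inverse of `cos_m` on `(0, π_m)`. -/
def genArccos (m : ℕ) : ℝ → ℝ := Function.invFunOn (genCos m) (Ioo 0 (genPi m))

lemma genCos_surjOn (hm : m ≠ 0) : SurjOn (genCos m) (Ioo 0 (genPi m)) (Ioo (-1) 1) := by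
  have := intermediate_value_Ioo' (genPi_pos hm).le
    (genCos_continuous hm).continuousOn (f := genCos m)
  rwa [genCos_zero hm, genCos_pi hm] at this

lemma genArccos_mem (hm : m ≠ 0) {z : ℝ} (hz : z ∈ Ioo (-1 : ℝ) 1) :
    genArccos m z ∈ Ioo 0 (genPi m) :=
  Function.invFunOn_mem (genCos_surjOn hm hz)

lemma genCos_genArccos (hm : m ≠ 0) {z : ℝ} (hz : z ∈ Ioo (-1 : ℝ) 1) :
    genCos m (genArccos m z) = z :=
  Function.invFunOn_eq (genCos_surjOn hm hz)

/-- Near `z`, the inverse obtained by choice agrees with the local inverse of the inverse function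
theorem, because `cos_m` is injective on `[0, π_m]`. The theorem applies because `sin_m` does not
vanish inside that interval. -/
lemma differentiableAt_genArccos (hm : m ≠ 0) {z : ℝ} (hz : z ∈ Ioo (-1 : ℝ) 1) :
    DifferentiableAt ℝ (genArccos m) z := by
  have hmem := genArccos_mem hm hz
  have hval := genCos_genArccos hm hz
  have hs : HasStrictDerivAt (genCos m)
      (-(m * genSin m (genArccos m z) ^ (2 * m - 1))) (genArccos m z) := by
    refine hasStrictDerivAt_of_hasDerivAt_of_continuousAt
      (f' := fun y => -(m * genSin m y ^ (2 * m - 1)))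
      (Eventually.of_forall fun y => hasDerivAt_genCos hm y) ?_
    exact (continuous_const.mul ((genSin_continuous hm).pow _)).neg.continuousAt
  have hne : -(m * genSin m (genArccos m z) ^ (2 * m - 1) : ℝ) ≠ 0 := by
    have := genSin_pos hm hmem
    have : (0 : ℝ) < m * genSin m (genArccos m z) ^ (2 * m - 1) := by positivity
    linarith
  have hl := hs.to_localInverse hne
  rw [hval] at hl
  have hc : Tendsto (hs.localInverse _ _ _ hne) (𝓝 z) (𝓝 (genArccos m z)) := by
    have := (hs.hasStrictFDerivAt_equiv hne).localInverse_tendsto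
    rwa [hval] at this
  have hr : ∀ᶠ w in 𝓝 z, genCos m (hs.localInverse _ _ _ hne w) = w := by
    have := (hs.hasStrictFDerivAt_equiv hne).eventually_right_inverse
    rwa [hval] at this
  refine hl.hasDerivAt.differentiableAt.congr_of_eventuallyEq ?_
  filter_upwards [hr, hc.eventually (Ioo_mem_nhds hmem.1 hmem.2), Ioo_mem_nhds hz.1 hz.2]
    with w h1 h2 h3
  refine (genCos_strictAntiOn hm).injOn (Ioo_subset_Icc_self (genArccos_mem hm h3))
    (Ioo_subset_Icc_self h2) ?_
  rw [genCos_genArccos hm h3, h1]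

/-- The expression vanishes at 0 and has derivative `m y sin_m(y)^(2m-1)`, positive on the open
interval. It is `focal m 0 y`. -/
lemma genSin_sub_mul_genCos_pos (hm : m ≠ 0) {y : ℝ} (hy : y ∈ Ioc 0 (genPi m)) :
    0 < genSin m y - y * genCos m y := by
  have hd : ∀ z, HasDerivAt (fun z => genSin m z - z * genCos m z)
      (z * (m * genSin m z ^ (2 * m - 1))) z := fun z =>
    ((hasDerivAt_genSin hm z).sub ((hasDerivAt_id' z).mul (hasDerivAt_genCos hm z))).congr_deriv
      (by ring)
  have hmono : StrictMonoOn (fun z => genSin m z - z * genCos m z) (Icc 0 (genPi m)) := by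
    refine strictMonoOn_of_deriv_pos (convex_Icc _ _)
      (fun z _ => (hd z).continuousAt.continuousWithinAt) ?_
    intro z hz
    rw [interior_Icc] at hz
    rw [(hd z).deriv]
    have := genSin_pos hm hz
    have := hz.1
    positivity
  have := hmono ⟨le_rfl, (genPi_pos hm).le⟩ (Ioc_subset_Icc_self hy) hy.1
  simpa [genSin_zero hm] using this

/-! ### The focal determinant -/

/-- The determinant deciding whether an oscillator arc from phase `ψ` to phase `θ` admits a
non-trivial variation that fixes its endpoints and scales its energy and its duration together. -/
def focal (m : ℕ) (ψ θ : ℝ) : ℝ :=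
  genSin m θ * genCos m ψ - genCos m θ * genSin m ψ - (θ - ψ) * (genCos m θ * genCos m ψ)

lemma focal_self (ψ : ℝ) : focal m ψ ψ = 0 := by
  simp only [focal]
  ring

/-- After exactly half a period the determinant vanishes only if the oscillator starts at rest. This
is the source of the equality case. -/
lemma focal_add_pi (hm : m ≠ 0) (ψ : ℝ) :
    focal m ψ (ψ + genPi m) = genPi m * genCos m ψ ^ 2 := by
  simp only [focal, genSin_add_pi hm, genCos_add_pi hm]
  ring

lemma focal_sub_pi (hm : m ≠ 0) (θ : ℝ) :
    focal m (θ - genPi m) θ = genPi m * genCos m θ ^ 2 := by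
  have h := focal_add_pi hm (θ - genPi m)
  have h2 := genCos_add_pi hm (θ - genPi m)
  rw [sub_add_cancel] at h h2
  rw [h, h2, neg_sq]

lemma hasDerivAt_focal_right (hm : m ≠ 0) (ψ θ : ℝ) :
    HasDerivAt (fun θ => focal m ψ θ)
      (m * genSin m θ ^ (2 * m - 1) * (genSin m ψ + (θ - ψ) * genCos m ψ)) θ := by
  have hs := hasDerivAt_genSin hm θ
  have hc := hasDerivAt_genCos hm θ
  exact (((hs.mul_const _).sub (hc.mul_const _)).sub
    (((hasDerivAt_id' θ).sub_const ψ).mul (hc.mul_const _))).congr_deriv (by ring)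

lemma hasDerivAt_focal_left (hm : m ≠ 0) (ψ θ : ℝ) :
    HasDerivAt (fun ψ => focal m ψ θ)
      (-(m * genSin m ψ ^ (2 * m - 1) * (genSin m θ - (θ - ψ) * genCos m θ))) ψ := by
  have hs := hasDerivAt_genSin hm ψ
  have hc := hasDerivAt_genCos hm ψ
  exact (((hc.const_mul _).sub (hs.const_mul _)).sub
    (((hasDerivAt_id' ψ).const_sub θ).mul (hc.const_mul _))).congr_deriv (by ring)

/-- Each partial derivative of `focal` is a product whose sign is readable from the quadrants of the
phases. If `cos ψ ≥ 0`, let `θ` vary: `focal` rises from 0 at `ψ` until `π_m`, then falls towards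
`π_m cos²ψ ≥ 0` at `ψ + π_m`. If `cos ψ < 0 ≤ cos θ`, let `ψ` vary: `focal` exceeds its value `π_m
cos²θ ≥ 0` at `θ - π_m`. If both cosines are negative and `θ ≤ π_m`, `focal` decreases in `ψ` to 0
at `ψ = θ`; for `θ > π_m` an explicit splitting is used. -/
lemma focal_pos (hm : m ≠ 0) {ψ θ : ℝ} (hψ : ψ ∈ Ioo 0 (genPi m))
    (hθ : θ ∈ Ioo ψ (ψ + genPi m)) : 0 < focal m ψ θ := by
  have hpi := genPi_pos hm
  have hm' : (0 : ℝ) < m := by positivity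
  have hodd : Odd (2 * m - 1) := ⟨m - 1, by omega⟩
  have hsψ := genSin_pos hm hψ
  rcases le_or_gt 0 (genCos m ψ) with hc | hc
  · have hfac : ∀ z, ψ < z → 0 < genSin m ψ + (z - ψ) * genCos m ψ := by
      intro z hz
      have : 0 ≤ (z - ψ) * genCos m ψ := mul_nonneg (by linarith) hc
      linarith
    by_cases h : θ ≤ genPi m
    · have hmono : StrictMonoOn (fun θ => focal m ψ θ) (Icc ψ (genPi m)) := by
        refine strictMonoOn_of_deriv_pos (convex_Icc _ _)
          (fun z _ => (hasDerivAt_focal_right hm ψ z).continuousAt.continuousWithinAt) ?_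
        intro z hz
        rw [interior_Icc] at hz
        rw [(hasDerivAt_focal_right hm ψ z).deriv]
        have h1 := hfac z hz.1
        have h2 := genSin_pos hm ⟨hψ.1.trans hz.1, hz.2⟩
        positivity
      have := hmono ⟨le_rfl, hψ.2.le⟩ ⟨hθ.1.le, h⟩ hθ.1
      simpa only [focal_self] using this
    · push Not at h
      have hanti : StrictAntiOn (fun θ => focal m ψ θ) (Icc (genPi m) (ψ + genPi m)) := by
        refine strictAntiOn_of_deriv_neg (convex_Icc _ _)
          (fun z _ => (hasDerivAt_focal_right hm ψ z).continuousAt.continuousWithinAt) ?_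
        intro z hz
        rw [interior_Icc] at hz
        rw [(hasDerivAt_focal_right hm ψ z).deriv]
        have h1 := hfac z (hψ.2.trans hz.1)
        have h2 := genSin_neg_of_mem hm ⟨hz.1, by linarith [hψ.2, hz.2]⟩
        exact mul_neg_of_neg_of_pos (mul_neg_of_pos_of_neg hm' (hodd.pow_neg h2)) h1
      have := hanti ⟨h.le, hθ.2.le⟩ ⟨by linarith [hψ.1], le_rfl⟩ hθ.2
      simp only [focal_add_pi hm] at this
      exact lt_of_le_of_lt (by positivity) this
  · have hψ2 : genPi m / 2 < ψ := by
      by_contra hcon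
      push Not at hcon
      have := (genCos_strictAntiOn hm).antitoneOn ⟨hψ.1.le, hψ.2.le⟩
        ⟨by linarith, by linarith⟩ hcon
      rw [genCos_half hm] at this
      linarith
    rcases lt_or_ge (genCos m θ) 0 with hcθ | hcθ
    · by_cases h : θ ≤ genPi m
      · have hanti : StrictAntiOn (fun ψ => focal m ψ θ) (Icc ψ θ) := by
          refine strictAntiOn_of_deriv_neg (convex_Icc _ _)
            (fun z _ => (hasDerivAt_focal_left hm z θ).continuousAt.continuousWithinAt) ?_
          intro z hz
          rw [interior_Icc] at hz
          rw [(hasDerivAt_focal_left hm z θ).deriv, neg_lt_zero]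
          have h1 := genSin_pos hm ⟨hψ.1.trans hz.1, hz.2.trans_le h⟩
          have h2 := genSin_nonneg hm ⟨by linarith [hψ.1, hθ.1], h⟩
          have h3 : (θ - z) * genCos m θ < 0 := mul_neg_of_pos_of_neg (by linarith [hz.2]) hcθ
          have h4 : 0 < genSin m θ - (θ - z) * genCos m θ := by linarith
          positivity
        have := hanti ⟨le_rfl, hθ.1.le⟩ ⟨hθ.1.le, le_rfl⟩ hθ.1
        simpa only [focal_self] using this
      · push Not at h
        have e1 := genSin_add_pi hm (θ - genPi m)
        have e2 := genCos_add_pi hm (θ - genPi m)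
        rw [sub_add_cancel] at e1 e2
        have e3 := genSin_pi_sub hm ψ
        have e4 := genCos_pi_sub hm ψ
        have h1 := genSin_sub_mul_genCos_pos hm (y := θ - genPi m)
          ⟨by linarith, by linarith [hθ.2, hψ.2]⟩
        have h2 := genSin_sub_mul_genCos_pos hm (y := genPi m - ψ)
          ⟨by linarith [hψ.2], by linarith [hψ.1]⟩
        have h5 : 0 < genCos m (genPi m - ψ) := by linarith
        have h6 : 0 < genCos m (θ - genPi m) := by linarith
        -- With `a = θ - π_m` and `b = π_m - ψ`, `focal` equals `cos b (sin a - a cos a) + cos a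
        -- (sin b - b cos b)`.
        have h7 := add_pos (mul_pos h5 h1) (mul_pos h6 h2)
        rw [focal, e1, e2, ← e3, show genCos m ψ = -genCos m (genPi m - ψ) by linarith]
        linarith
    · have hθ3 : genPi m < θ := by
        by_contra hcon
        push Not at hcon
        have := genCos_strictAntiOn hm ⟨by linarith, by linarith⟩
          ⟨by linarith [hψ.1, hθ.1], hcon⟩ (hψ2.trans hθ.1)
        rw [genCos_half hm] at this
        linarith
      have hsθ := genSin_neg_of_mem hm (y := θ) ⟨hθ3, by linarith [hψ.2, hθ.2]⟩
      have hmono : StrictMonoOn (fun ψ => focal m ψ θ) (Icc (θ - genPi m) ψ) := by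
        refine strictMonoOn_of_deriv_pos (convex_Icc _ _)
          (fun z _ => (hasDerivAt_focal_left hm z θ).continuousAt.continuousWithinAt) ?_
        intro z hz
        rw [interior_Icc] at hz
        rw [(hasDerivAt_focal_left hm z θ).deriv, neg_pos]
        have h1 := genSin_pos hm (y := z) ⟨by linarith [hz.1], hz.2.trans hψ.2⟩
        have h3 : 0 ≤ (θ - z) * genCos m θ := mul_nonneg (by linarith [hz.2, hθ.1]) hcθ
        exact mul_neg_of_pos_of_neg (by positivity) (by linarith)
      have := hmono ⟨le_rfl, by linarith [hθ.2]⟩ ⟨by linarith [hθ.2], le_rfl⟩ (by linarith [hθ.2])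
      simp only [focal_sub_pi hm] at this
      exact lt_of_le_of_lt (by positivity) this

end TrigExtra

/-! ### The oscillator `x' = p`, `p' = -m c x^{2m-1}` -/

/-- The conserved energy `p² + c x^{2m}`. -/
def oscEnergy (m : ℕ) (x₀ p c : ℝ) : ℝ := p ^ 2 + c * x₀ ^ (2 * m)

/-- The amplitude of the oscillation. -/
def oscAmp (m : ℕ) (x₀ p c : ℝ) : ℝ := (oscEnergy m x₀ p c / c) ^ (1 / (2 * m : ℝ))

/-- The initial phase of the oscillation. -/
def oscPhase (m : ℕ) (x₀ p c : ℝ) : ℝ :=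
  genArccos m (x₀ / |x₀| * p / Real.sqrt (oscEnergy m x₀ p c))

/-- The angular frequency of the oscillation. -/
def oscFreq (m : ℕ) (x₀ p c : ℝ) : ℝ := Real.sqrt (oscEnergy m x₀ p c) / oscAmp m x₀ p c

/-- The phase at time `s`. -/
def oscAngle (m : ℕ) (x₀ p c s : ℝ) : ℝ := oscPhase m x₀ p c + oscFreq m x₀ p c * s

/-- The position at time `s`. -/
def oscPos (m : ℕ) (x₀ p c s : ℝ) : ℝ :=
  if m = 0 then x₀ + p * s
  else x₀ / |x₀| * oscAmp m x₀ p c * genSin m (oscAngle m x₀ p c s)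

/-- The momentum at time `s`. -/
def oscMom (m : ℕ) (x₀ p c s : ℝ) : ℝ :=
  if m = 0 then p
  else x₀ / |x₀| * Real.sqrt (oscEnergy m x₀ p c) * genCos m (oscAngle m x₀ p c s)

/-- The integral of `x^{2m}` from time `0` to time `s`. -/
def oscClock (m : ℕ) (x₀ p c s : ℝ) : ℝ :=
  (oscEnergy m x₀ p c * s - (oscPos m x₀ p c s * oscMom m x₀ p c s - x₀ * p)) / ((m + 1) * c)

section Osc

variable {m : ℕ} {x₀ p c : ℝ}

/-- The condition on `x₀` is the Riemannian condition for a single level. For `m = 0` the potential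
term is the constant `c`, and `x₀` may vanish. -/
lemma oscEnergy_pos (hx : m ≠ 0 → x₀ ≠ 0) (hc : 0 < c) : 0 < oscEnergy m x₀ p c := by
  have h : 0 < x₀ ^ (2 * m) := by
    by_cases hm : m = 0
    · simp [hm]
    · exact (even_two_mul m).pow_pos (hx hm)
  have := mul_pos hc h
  rw [oscEnergy]
  positivity

lemma div_abs_sq {x : ℝ} (hx : x ≠ 0) : (x / |x|) ^ 2 = 1 := by
  rw [div_pow, sq_abs, div_self (pow_ne_zero _ hx)]

lemma oscAmp_pos (hx : m ≠ 0 → x₀ ≠ 0) (hc : 0 < c) : 0 < oscAmp m x₀ p c :=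
  Real.rpow_pos_of_pos (div_pos (oscEnergy_pos hx hc) hc) _

lemma oscAmp_pow (hm : m ≠ 0) (hx : m ≠ 0 → x₀ ≠ 0) (hc : 0 < c) :
    c * oscAmp m x₀ p c ^ (2 * m) = oscEnergy m x₀ p c := by
  have hE := oscEnergy_pos (p := p) hx hc
  have hm' : (m : ℝ) ≠ 0 := by exact_mod_cast hm
  rw [oscAmp, ← Real.rpow_natCast, ← Real.rpow_mul (div_pos hE hc).le]
  push_cast
  rw [one_div_mul_cancel (by positivity), Real.rpow_one]
  field_simp

lemma oscPhase_arg_mem (hm : m ≠ 0) (hx : m ≠ 0 → x₀ ≠ 0) (hc : 0 < c) :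
    x₀ / |x₀| * p / Real.sqrt (oscEnergy m x₀ p c) ∈ Ioo (-1 : ℝ) 1 := by
  have hE := oscEnergy_pos (p := p) hx hc
  have hpos : 0 < c * x₀ ^ (2 * m) := mul_pos hc ((even_two_mul m).pow_pos (hx hm))
  rw [mem_Ioo, ← abs_lt, ← sq_lt_one_iff_abs_lt_one, div_pow, mul_pow, div_abs_sq (hx hm),
    Real.sq_sqrt hE.le, one_mul, div_lt_one hE, oscEnergy]
  linarith

lemma oscPhase_mem (hm : m ≠ 0) (hx : m ≠ 0 → x₀ ≠ 0) (hc : 0 < c) :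
    oscPhase m x₀ p c ∈ Ioo 0 (genPi m) :=
  genArccos_mem hm (oscPhase_arg_mem hm hx hc)

lemma genCos_oscPhase (hm : m ≠ 0) (hx : m ≠ 0 → x₀ ≠ 0) (hc : 0 < c) :
    genCos m (oscPhase m x₀ p c) = x₀ / |x₀| * p / Real.sqrt (oscEnergy m x₀ p c) :=
  genCos_genArccos hm (oscPhase_arg_mem hm hx hc)

/-- Both sides are nonnegative and have the same `2m`-th power, by the Pythagorean identity and the
conserved energy. -/
lemma oscAmp_mul_genSin_oscPhase (hm : m ≠ 0) (hx : m ≠ 0 → x₀ ≠ 0) (hc : 0 < c) :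
    oscAmp m x₀ p c * genSin m (oscPhase m x₀ p c) = |x₀| := by
  have hE := oscEnergy_pos (p := p) hx hc
  have h := genCos_sq_add hm (oscPhase m x₀ p c)
  rw [genCos_oscPhase hm hx hc, div_pow, mul_pow, div_abs_sq (hx hm), Real.sq_sqrt hE.le,
    one_mul] at h
  have ha := oscAmp_pow (p := p) hm hx hc
  have hs := (genSin_pos hm (oscPhase_mem (p := p) hm hx hc)).le
  refine (pow_left_inj₀ (mul_nonneg (oscAmp_pos hx hc).le hs) (abs_nonneg _)
    (show 2 * m ≠ 0 by omega)).1 ?_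
  rw [(even_two_mul m).pow_abs, mul_pow]
  have hE2 : oscEnergy m x₀ p c = p ^ 2 + c * x₀ ^ (2 * m) := rfl
  field_simp at h
  have h2 : c * (oscAmp m x₀ p c ^ (2 * m) * genSin m (oscPhase m x₀ p c) ^ (2 * m)) =
      c * x₀ ^ (2 * m) := by
    rw [← mul_assoc, ha]
    linarith
  exact mul_left_cancel₀ hc.ne' h2

lemma oscFreq_pos (hx : m ≠ 0 → x₀ ≠ 0) (hc : 0 < c) : 0 < oscFreq m x₀ p c :=
  div_pos (Real.sqrt_pos.2 (oscEnergy_pos hx hc)) (oscAmp_pos hx hc)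

lemma oscPos_zero (hx : m ≠ 0 → x₀ ≠ 0) (hc : 0 < c) : oscPos m x₀ p c 0 = x₀ := by
  by_cases hm : m = 0
  · simp [oscPos, hm]
  · rw [oscPos, if_neg hm, oscAngle, mul_zero, add_zero, mul_assoc,
      oscAmp_mul_genSin_oscPhase hm hx hc]
    exact div_mul_cancel₀ _ (abs_pos.2 (hx hm)).ne'

lemma oscMom_zero (hx : m ≠ 0 → x₀ ≠ 0) (hc : 0 < c) : oscMom m x₀ p c 0 = p := by
  by_cases hm : m = 0
  · simp [oscMom, hm]
  · have hs := Real.sqrt_pos.2 (oscEnergy_pos (p := p) hx hc)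
    rw [oscMom, if_neg hm, oscAngle, mul_zero, add_zero, genCos_oscPhase hm hx hc]
    have := div_abs_sq (hx hm)
    calc _ = (x₀ / |x₀|) ^ 2 * p := by field_simp
      _ = p := by rw [this, one_mul]

lemma oscClock_zero (hx : m ≠ 0 → x₀ ≠ 0) (hc : 0 < c) : oscClock m x₀ p c 0 = 0 := by
  simp [oscClock, oscPos_zero hx hc, oscMom_zero hx hc]

lemma oscMom_sq_add (hx : m ≠ 0 → x₀ ≠ 0) (hc : 0 < c) (s : ℝ) :
    oscMom m x₀ p c s ^ 2 + c * oscPos m x₀ p c s ^ (2 * m) = oscEnergy m x₀ p c := by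
  by_cases hm : m = 0
  · simp [oscMom, oscEnergy, hm]
  · have h := genCos_sq_add hm (oscAngle m x₀ p c s)
    rw [oscMom, oscPos, if_neg hm, if_neg hm, mul_pow, mul_pow, mul_pow, mul_pow, pow_mul (_ / _),
      div_abs_sq (hx hm), one_pow, one_mul, one_mul, Real.sq_sqrt (oscEnergy_pos hx hc).le,
      ← mul_assoc, oscAmp_pow hm hx hc, ← mul_add, h, mul_one]

lemma hasDerivAt_oscAngle (s : ℝ) :
    HasDerivAt (fun s => oscAngle m x₀ p c s) (oscFreq m x₀ p c) s :=
  (((hasDerivAt_id' s).const_mul _).const_add _).congr_deriv (mul_one _)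

lemma hasDerivAt_oscPos (hx : m ≠ 0 → x₀ ≠ 0) (hc : 0 < c) (s : ℝ) :
    HasDerivAt (fun s => oscPos m x₀ p c s) (oscMom m x₀ p c s) s := by
  by_cases hm : m = 0
  · simp only [oscPos, oscMom, hm, if_true]
    exact (((hasDerivAt_id' s).const_mul _).const_add _).congr_deriv (mul_one _)
  · simp only [oscPos, oscMom, if_neg hm]
    refine (((hasDerivAt_genSin hm _).comp s (hasDerivAt_oscAngle s)).const_mul _).congr_deriv ?_
    have := oscAmp_pos (p := p) hx hc
    rw [oscFreq]
    field_simp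

lemma hasDerivAt_oscMom (hx : m ≠ 0 → x₀ ≠ 0) (hc : 0 < c) (s : ℝ) :
    HasDerivAt (fun s => oscMom m x₀ p c s) (-(m * c * oscPos m x₀ p c s ^ (2 * m - 1))) s := by
  by_cases hm : m = 0
  · subst hm
    simp only [oscMom, if_true]
    exact (hasDerivAt_const s p).congr_deriv (by simp)
  · simp only [oscPos, oscMom, if_neg hm]
    refine (((hasDerivAt_genCos hm _).comp s (hasDerivAt_oscAngle s)).const_mul _).congr_deriv ?_
    have ha := oscAmp_pos (p := p) hx hc
    have hE := oscEnergy_pos (p := p) hx hc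
    have h1 := oscAmp_pow (p := p) hm hx hc
    have h2 : (2 * m - 1) + 1 = 2 * m := by omega
    rw [← h2, pow_succ, ← mul_assoc] at h1
    have h3 : (x₀ / |x₀|) ^ (2 * m - 1) = x₀ / |x₀| := by
      rw [show 2 * m - 1 = 2 * (m - 1) + 1 by omega, pow_succ, pow_mul, div_abs_sq (hx hm),
        one_pow, one_mul]
    have h4 : Real.sqrt (oscEnergy m x₀ p c) * oscFreq m x₀ p c =
        c * oscAmp m x₀ p c ^ (2 * m - 1) := by
      rw [oscFreq, mul_div_assoc', Real.mul_self_sqrt hE.le, ← h1]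
      field_simp
    rw [mul_pow, mul_pow, h3]
    calc _ = -(x₀ / |x₀| * m * genSin m (oscAngle m x₀ p c s) ^ (2 * m - 1) *
          (Real.sqrt (oscEnergy m x₀ p c) * oscFreq m x₀ p c)) := by ring
      _ = _ := by
        rw [h4]
        ring

/-- Virial identity: `(x p)' = p² - m c x^(2m) = E - (m+1) c x^(2m)`. This is what makes the
integral of `x^(2m)` explicit. -/
lemma hasDerivAt_oscClock (hx : m ≠ 0 → x₀ ≠ 0) (hc : 0 < c) (s : ℝ) :
    HasDerivAt (fun s => oscClock m x₀ p c s) (oscPos m x₀ p c s ^ (2 * m)) s := by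
  have h1 := ((hasDerivAt_id' s).const_mul (oscEnergy m x₀ p c)).sub
    (((hasDerivAt_oscPos (p := p) hx hc s).mul (hasDerivAt_oscMom (p := p) hx hc s)).sub_const (x₀ * p))
  refine (h1.div_const ((m + 1) * c)).congr_deriv ?_
  rw [← oscMom_sq_add hx hc s, div_eq_iff (by positivity)]
  by_cases hm : m = 0
  · subst hm
    simp
    ring
  · have h2 : oscPos m x₀ p c s ^ (2 * m) =
        oscPos m x₀ p c s * oscPos m x₀ p c s ^ (2 * m - 1) := by
      rw [← pow_succ']
      congr 1
      omega
    rw [h2]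
    ring

/-- The clock never decreases. If it stalled on an interval, position and hence momentum would
vanish there, against positive energy. -/
lemma oscClock_strictMono (hx : m ≠ 0 → x₀ ≠ 0) (hc : 0 < c) :
    StrictMono (fun s => oscClock m x₀ p c s) := by
  have hmono : Monotone (fun s => oscClock m x₀ p c s) :=
    monotone_of_deriv_nonneg (fun s => (hasDerivAt_oscClock hx hc s).differentiableAt)
      (fun s => by
        rw [(hasDerivAt_oscClock hx hc s).deriv]
        exact (even_two_mul m).pow_nonneg _)
  intro a b h
  refine lt_of_le_of_ne (hmono h.le) fun hab => ?_
  have hzero : ∀ s ∈ Ioo a b, oscPos m x₀ p c s ^ (2 * m) = 0 := by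
    intro s hs
    refine (hasDerivAt_oscClock hx hc s).unique ?_
    refine (hasDerivAt_const s (oscClock m x₀ p c a)).congr_of_eventuallyEq ?_
    filter_upwards [Ioo_mem_nhds hs.1 hs.2] with z hz
    exact le_antisymm ((hmono hz.2.le).trans hab.symm.le) (hmono hz.1.le)
  obtain ⟨s, hs⟩ := exists_between h
  have hp : ∀ z ∈ Ioo a b, oscPos m x₀ p c z = 0 := fun z hz => by
    have hm : m ≠ 0 := by
      rintro rfl
      simpa using hzero z hz
    exact eq_zero_of_pow_eq_zero (hzero z hz)
  have hmom : oscMom m x₀ p c s = 0 := by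
    refine (hasDerivAt_oscPos hx hc s).unique ?_
    refine (hasDerivAt_const s 0).congr_of_eventuallyEq ?_
    filter_upwards [Ioo_mem_nhds hs.1 hs.2] with z hz
    exact hp z hz
  have hE := oscMom_sq_add (p := p) hx hc s
  rw [hmom, hzero s hs] at hE
  have := oscEnergy_pos (p := p) hx hc
  simp at hE
  linarith

/-- For `m = 0` the clock is the identity. Otherwise the linear term `E s` outgrows the bounded
product of position and momentum. -/
lemma oscClock_tendsto (hx : m ≠ 0 → x₀ ≠ 0) (hc : 0 < c) :
    Tendsto (fun s => oscClock m x₀ p c s) atTop atTop := by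
  have hE := oscEnergy_pos (p := p) hx hc
  by_cases hm : m = 0
  · subst hm
    have : (fun s => oscClock 0 x₀ p c s) = id := by
      ext s
      simp only [oscClock, oscPos, oscMom, oscEnergy, if_true]
      field_simp
      simp
      ring
    rw [this]
    exact tendsto_id
  · have hden : 0 < ((m : ℝ) + 1) * c := by positivity
    refine Tendsto.atTop_div_const hden ?_
    set K := oscAmp m x₀ p c * Real.sqrt (oscEnergy m x₀ p c)
    have hK : 0 ≤ K := mul_nonneg (oscAmp_pos hx hc).le (Real.sqrt_nonneg _)
    have hb : ∀ s, oscPos m x₀ p c s * oscMom m x₀ p c s - x₀ * p ≤ K - x₀ * p := by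
      intro s
      have h1 : oscPos m x₀ p c s * oscMom m x₀ p c s = K *
          (genSin m (oscAngle m x₀ p c s) * genCos m (oscAngle m x₀ p c s)) := by
        rw [oscPos, oscMom, if_neg hm, if_neg hm]
        calc _ = (x₀ / |x₀|) ^ 2 * K *
          (genSin m (oscAngle m x₀ p c s) * genCos m (oscAngle m x₀ p c s)) := by ring
          _ = _ := by rw [div_abs_sq (hx hm), one_mul]
      have h2 : genSin m (oscAngle m x₀ p c s) * genCos m (oscAngle m x₀ p c s) ≤ 1 := by
        refine (le_abs_self _).trans ?_
        rw [abs_mul]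
        exact mul_le_one₀ (abs_genSin_le_one hm _) (abs_nonneg _) (abs_genCos_le_one hm _)
      have := mul_le_mul_of_nonneg_left h2 hK
      linarith
    refine tendsto_atTop_mono (fun s => sub_le_sub_left (hb s) _) ?_
    exact tendsto_atTop_add_const_right _ _ (tendsto_id.const_mul_atTop hE)

/-- The clock in terms of amplitude, energy, frequency and phases, which is the form differentiated
in the variational formulas. -/
lemma oscClock_eq (hm : m ≠ 0) (hx : m ≠ 0 → x₀ ≠ 0) (hc : 0 < c) (s : ℝ) :
    (m + 1) * c * oscClock m x₀ p c s =
      oscAmp m x₀ p c * Real.sqrt (oscEnergy m x₀ p c) * (oscFreq m x₀ p c * s -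
        (genSin m (oscAngle m x₀ p c s) * genCos m (oscAngle m x₀ p c s) -
          genSin m (oscPhase m x₀ p c) * genCos m (oscPhase m x₀ p c))) := by
  have hE := oscEnergy_pos (p := p) hx hc
  have ha := oscAmp_pos (p := p) hx hc
  have h1 : ∀ s, oscPos m x₀ p c s * oscMom m x₀ p c s =
      oscAmp m x₀ p c * Real.sqrt (oscEnergy m x₀ p c) *
        (genSin m (oscAngle m x₀ p c s) * genCos m (oscAngle m x₀ p c s)) := by
    intro s
    rw [oscPos, oscMom, if_neg hm, if_neg hm]
    calc _ = (x₀ / |x₀|) ^ 2 * (oscAmp m x₀ p c * Real.sqrt (oscEnergy m x₀ p c)) *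
          (genSin m (oscAngle m x₀ p c s) * genCos m (oscAngle m x₀ p c s)) := by ring
      _ = _ := by rw [div_abs_sq (hx hm), one_mul]
  have h2 := h1 0
  rw [oscPos_zero hx hc, oscMom_zero hx hc, oscAngle, mul_zero, add_zero] at h2
  have h3 : oscAmp m x₀ p c * Real.sqrt (oscEnergy m x₀ p c) * oscFreq m x₀ p c =
      oscEnergy m x₀ p c := by
    rw [oscFreq, mul_assoc, mul_div_assoc', Real.mul_self_sqrt hE.le]
    field_simp
  rw [oscClock, mul_div_cancel₀ _ (by positivity), h1, h2]
  nth_rewrite 1 [← h3]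
  ring

/-! Scaling -/

/-- Replacing the covector by `t` times itself multiplies `p` by `t` and the coefficient `c` by
`t²`. For `t > 0` this keeps amplitude and initial phase and multiplies the frequency by `t`, so the
same orbit is run `t` times faster. -/
lemma oscEnergy_scale (t : ℝ) :
    oscEnergy m x₀ (t * p) (t ^ 2 * c) = t ^ 2 * oscEnergy m x₀ p c := by
  simp only [oscEnergy]
  ring

lemma oscAmp_scale {t : ℝ} (ht : 0 < t) : oscAmp m x₀ (t * p) (t ^ 2 * c) = oscAmp m x₀ p c := by
  rw [oscAmp, oscEnergy_scale, mul_div_mul_left _ _ (by positivity), oscAmp]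

lemma sqrt_oscEnergy_scale {t : ℝ} (ht : 0 < t) :
    Real.sqrt (oscEnergy m x₀ (t * p) (t ^ 2 * c)) = t * Real.sqrt (oscEnergy m x₀ p c) := by
  rw [oscEnergy_scale, Real.sqrt_mul (by positivity), Real.sqrt_sq ht.le]

lemma oscPhase_scale {t : ℝ} (ht : 0 < t) :
    oscPhase m x₀ (t * p) (t ^ 2 * c) = oscPhase m x₀ p c := by
  rw [oscPhase, sqrt_oscEnergy_scale ht, oscPhase, mul_left_comm, mul_div_mul_left _ _ ht.ne']

lemma oscAngle_scale {t : ℝ} (ht : 0 < t) (s : ℝ) :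
    oscAngle m x₀ (t * p) (t ^ 2 * c) s = oscAngle m x₀ p c (t * s) := by
  rw [oscAngle, oscAngle, oscPhase_scale ht, oscFreq, oscFreq, oscAmp_scale ht,
    sqrt_oscEnergy_scale ht]
  ring

lemma oscClock_scale {t : ℝ} (ht : 0 < t) (s : ℝ) :
    t * oscClock m x₀ (t * p) (t ^ 2 * c) s = oscClock m x₀ p c (t * s) := by
  have h1 : oscPos m x₀ (t * p) (t ^ 2 * c) s = oscPos m x₀ p c (t * s) := by
    simp only [oscPos, oscAngle_scale ht, oscAmp_scale ht]
    split_ifs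
    · ring
    · rfl
  have h2 : oscMom m x₀ (t * p) (t ^ 2 * c) s = t * oscMom m x₀ p c (t * s) := by
    simp only [oscMom, oscAngle_scale ht, sqrt_oscEnergy_scale ht]
    split_ifs
    · ring
    · ring
  rw [oscClock, oscClock, h1, h2, oscEnergy_scale]
  have : ((m : ℝ) + 1) ≠ 0 := by positivity
  by_cases hc : c = 0
  · simp [hc]
  field_simp

/-! Differentiable dependence on parameters -/

section Param

variable {V : Type*} [NormedAddCommGroup V] [NormedSpace ℝ V] {v : V} {f g h : V → ℝ}

lemma differentiableAt_div_real (hf : DifferentiableAt ℝ f v) (hg : DifferentiableAt ℝ g v)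
    (h0 : g v ≠ 0) : DifferentiableAt ℝ (fun w => f w / g w) v := by
  simp only [div_eq_mul_inv]
  exact hf.fun_mul (hg.fun_inv h0)

lemma differentiableAt_oscEnergy (hf : DifferentiableAt ℝ f v) (hg : DifferentiableAt ℝ g v) :
    DifferentiableAt ℝ (fun w => oscEnergy m x₀ (f w) (g w)) v := by
  simp only [oscEnergy]
  fun_prop

lemma differentiableAt_oscAmp (hx : m ≠ 0 → x₀ ≠ 0) (hc : 0 < g v)
    (hf : DifferentiableAt ℝ f v) (hg : DifferentiableAt ℝ g v) :
    DifferentiableAt ℝ (fun w => oscAmp m x₀ (f w) (g w)) v := by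
  have hE := oscEnergy_pos (p := f v) hx hc
  exact (differentiableAt_div_real (differentiableAt_oscEnergy hf hg) hg hc.ne').rpow_const
    (Or.inl (div_pos hE hc).ne')

lemma differentiableAt_sqrt_oscEnergy (hx : m ≠ 0 → x₀ ≠ 0) (hc : 0 < g v)
    (hf : DifferentiableAt ℝ f v) (hg : DifferentiableAt ℝ g v) :
    DifferentiableAt ℝ (fun w => Real.sqrt (oscEnergy m x₀ (f w) (g w))) v :=
  (differentiableAt_oscEnergy hf hg).sqrt (oscEnergy_pos hx hc).ne'

lemma differentiableAt_oscFreq (hx : m ≠ 0 → x₀ ≠ 0) (hc : 0 < g v)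
    (hf : DifferentiableAt ℝ f v) (hg : DifferentiableAt ℝ g v) :
    DifferentiableAt ℝ (fun w => oscFreq m x₀ (f w) (g w)) v :=
  differentiableAt_div_real (differentiableAt_sqrt_oscEnergy hx hc hf hg) (differentiableAt_oscAmp hx hc hf hg)
    (oscAmp_pos hx hc).ne'

lemma differentiableAt_oscPhase (hm : m ≠ 0) (hx : m ≠ 0 → x₀ ≠ 0) (hc : 0 < g v)
    (hf : DifferentiableAt ℝ f v) (hg : DifferentiableAt ℝ g v) :
    DifferentiableAt ℝ (fun w => oscPhase m x₀ (f w) (g w)) v :=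
  DifferentiableAt.comp (g := genArccos m) v
    (differentiableAt_genArccos hm (oscPhase_arg_mem hm hx hc))
    (differentiableAt_div_real (hf.const_mul _) (differentiableAt_sqrt_oscEnergy hx hc hf hg)
      (Real.sqrt_pos.2 (oscEnergy_pos hx hc)).ne')

lemma differentiableAt_oscAngle (hm : m ≠ 0) (hx : m ≠ 0 → x₀ ≠ 0) (hc : 0 < g v)
    (hf : DifferentiableAt ℝ f v) (hg : DifferentiableAt ℝ g v) (hh : DifferentiableAt ℝ h v) :
    DifferentiableAt ℝ (fun w => oscAngle m x₀ (f w) (g w) (h w)) v :=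
  (differentiableAt_oscPhase hm hx hc hf hg).add ((differentiableAt_oscFreq hx hc hf hg).mul hh)

lemma differentiableAt_oscPos (hx : m ≠ 0 → x₀ ≠ 0) (hc : 0 < g v)
    (hf : DifferentiableAt ℝ f v) (hg : DifferentiableAt ℝ g v) (hh : DifferentiableAt ℝ h v) :
    DifferentiableAt ℝ (fun w => oscPos m x₀ (f w) (g w) (h w)) v := by
  by_cases hm : m = 0
  · simp only [oscPos, if_pos hm]
    fun_prop
  · simp only [oscPos, if_neg hm]
    exact ((differentiableAt_oscAmp hx hc hf hg).const_mul _).mul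
      (DifferentiableAt.comp (g := genSin m) v (hasDerivAt_genSin hm _).differentiableAt
        (differentiableAt_oscAngle hm hx hc hf hg hh))

lemma differentiableAt_oscMom (hx : m ≠ 0 → x₀ ≠ 0) (hc : 0 < g v)
    (hf : DifferentiableAt ℝ f v) (hg : DifferentiableAt ℝ g v) (hh : DifferentiableAt ℝ h v) :
    DifferentiableAt ℝ (fun w => oscMom m x₀ (f w) (g w) (h w)) v := by
  by_cases hm : m = 0
  · simp only [oscMom, if_pos hm]
    fun_prop
  · simp only [oscMom, if_neg hm]
    exact ((differentiableAt_sqrt_oscEnergy hx hc hf hg).const_mul _).mul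
      (DifferentiableAt.comp (g := genCos m) v (hasDerivAt_genCos hm _).differentiableAt
        (differentiableAt_oscAngle hm hx hc hf hg hh))

lemma differentiableAt_oscClock (hx : m ≠ 0 → x₀ ≠ 0) (hc : 0 < g v)
    (hf : DifferentiableAt ℝ f v) (hg : DifferentiableAt ℝ g v) (hh : DifferentiableAt ℝ h v) :
    DifferentiableAt ℝ (fun w => oscClock m x₀ (f w) (g w) (h w)) v := by
  simp only [oscClock]
  refine differentiableAt_div_real ?_ (hg.const_mul _) (by positivity)
  exact ((differentiableAt_oscEnergy hf hg).mul hh).sub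
    (((differentiableAt_oscPos hx hc hf hg hh).mul (differentiableAt_oscMom hx hc hf hg hh)).sub
      (hf.const_mul _))

end Param

end Osc

/-! ### Variations of the oscillator -/

section Variation

variable {m : ℕ} {x₀ r p' c' s' : ℝ} {p c s : ℝ → ℝ}

lemma hasDerivAt_oscEnergy_param (hp : HasDerivAt p p' r) (hc : HasDerivAt c c' r) :
    HasDerivAt (fun r => oscEnergy m x₀ (p r) (c r)) (2 * p r * p' + c' * x₀ ^ (2 * m)) r :=
  ((hp.pow 2).add (hc.mul_const _)).congr_deriv (by simp)

/-- The first variation of the oscillator in terms of the logarithmic variation `u` of the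
amplitude and the variation `η` of the initial phase. -/
lemma exists_osc_variation (hm : m ≠ 0) (hx : m ≠ 0 → x₀ ≠ 0) (hc0 : 0 < c r)
    (hp : HasDerivAt p p' r) (hc : HasDerivAt c c' r) (hs : HasDerivAt s s' r)
    {A E ω ψ θ E' : ℝ} (hA : A = oscAmp m x₀ (p r) (c r)) (hE : E = oscEnergy m x₀ (p r) (c r))
    (hω : ω = oscFreq m x₀ (p r) (c r)) (hψ : ψ = oscPhase m x₀ (p r) (c r))
    (hθ : θ = oscAngle m x₀ (p r) (c r) (s r)) (hE' : E' = 2 * p r * p' + c' * x₀ ^ (2 * m)) :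
    ∃ u η θ' k' : ℝ, E' * c r = E * (c' + 2 * m * u * c r) ∧
      genCos m ψ * η = -(genSin m ψ * u) ∧
      p' = x₀ / |x₀| * (E' / (2 * Real.sqrt E) * genCos m ψ -
        Real.sqrt E * (m * genSin m ψ ^ (2 * m - 1) * η)) ∧
      θ' = η + ω * (s' + s r * (E' / (2 * E) - u)) ∧
      HasDerivAt (fun r => oscPos m x₀ (p r) (c r) (s r))
        (x₀ / |x₀| * A * (genSin m θ * u + genCos m θ * θ')) r ∧
      HasDerivAt (fun r => oscClock m x₀ (p r) (c r) (s r)) k' r ∧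
      (m + 1) * (c' * oscClock m x₀ (p r) (c r) (s r) + c r * k') =
        A * Real.sqrt E * ((u + E' / (2 * E)) *
          (ω * s r - (genSin m θ * genCos m θ - genSin m ψ * genCos m ψ)) +
          (m + 1) * (genSin m θ ^ (2 * m) * θ' - genSin m ψ ^ (2 * m) * η)) := by
  have hEpos : 0 < E := hE ▸ oscEnergy_pos hx hc0
  have hApos : 0 < A := hA ▸ oscAmp_pos hx hc0
  have hsE : 0 < Real.sqrt E := Real.sqrt_pos.2 hEpos
  have hsq : Real.sqrt E ^ 2 = E := Real.sq_sqrt hEpos.le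
  have hωA : ω * A = Real.sqrt E := by
    rw [hω, oscFreq, ← hA, ← hE, div_mul_cancel₀ _ hApos.ne']
  have hev : ∀ᶠ z in 𝓝 r, 0 < c z := hc.continuousAt.eventually (lt_mem_nhds hc0)
  have dE : HasDerivAt (fun r => oscEnergy m x₀ (p r) (c r)) E' r :=
    hE' ▸ hasDerivAt_oscEnergy_param hp hc
  have dsE : HasDerivAt (fun r => Real.sqrt (oscEnergy m x₀ (p r) (c r)))
      (E' / (2 * Real.sqrt E)) r := by
    have := dE.sqrt (by rw [← hE]; exact hEpos.ne')
    rwa [← hE] at this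
  obtain ⟨A', dA⟩ : ∃ A', HasDerivAt (fun r => oscAmp m x₀ (p r) (c r)) A' r :=
    ⟨_, (differentiableAt_oscAmp hx hc0 hp.differentiableAt hc.differentiableAt).hasDerivAt⟩
  obtain ⟨η, dψ⟩ : ∃ η, HasDerivAt (fun r => oscPhase m x₀ (p r) (c r)) η r :=
    ⟨_, (differentiableAt_oscPhase hm hx hc0 hp.differentiableAt hc.differentiableAt).hasDerivAt⟩
  obtain ⟨k', dk⟩ : ∃ k', HasDerivAt (fun r => oscClock m x₀ (p r) (c r) (s r)) k' r :=
    ⟨_, (differentiableAt_oscClock hx hc0 hp.differentiableAt hc.differentiableAt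
      hs.differentiableAt).hasDerivAt⟩
  obtain ⟨u, rfl⟩ : ∃ u, A' = A * u := ⟨A' / A, by field_simp⟩
  have dω : HasDerivAt (fun r => oscFreq m x₀ (p r) (c r)) (ω * (E' / (2 * E) - u)) r := by
    have := dsE.div dA (by rw [← hA]; exact hApos.ne')
    rw [← hA, ← hE] at this
    refine this.congr_deriv ?_
    rw [div_eq_iff (by positivity)]
    have h1 : ω * (E' / (2 * E) - u) * A ^ 2 = Real.sqrt E * A * (E' / (2 * E) - u) := by
      rw [← hωA]
      ring
    rw [h1]
    have h2 : E' / (2 * E) * Real.sqrt E = E' / (2 * Real.sqrt E) := by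
      nth_rewrite 1 [← hsq]
      field_simp
    rw [← h2]
    ring
  have dθ : HasDerivAt (fun r => oscAngle m x₀ (p r) (c r) (s r))
      (η + ω * (s' + s r * (E' / (2 * E) - u))) r := by
    have := dψ.add (dω.mul hs)
    rw [← hω] at this
    exact this.congr_deriv (by ring)
  have dsinθ := (hasDerivAt_genSin hm _).comp r dθ
  have dcosθ := (hasDerivAt_genCos hm _).comp r dθ
  have dsinψ := (hasDerivAt_genSin hm _).comp r dψ
  have dcosψ := (hasDerivAt_genCos hm _).comp r dψ
  rw [← hθ] at dsinθ dcosθ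
  rw [← hψ] at dsinψ dcosψ
  have hε := div_abs_sq (hx hm)
  -- The relations come from differentiating, in turn, `c A^(2m) = E`, `A sin ψ = |x₀|`, `p =
  -- (x₀/|x₀|) √E cos ψ`, the position formula and the clock formula.
  refine ⟨u, η, _, k', ?_, ?_, ?_, rfl, ?_, dk, ?_⟩
  · have h1 : HasDerivAt (fun r => oscEnergy m x₀ (p r) (c r))
        (c' * A ^ (2 * m) + c r * (2 * m * A ^ (2 * m - 1) * (A * u))) r := by
      have := hc.mul (dA.pow (2 * m))
      rw [Pi.pow_apply, ← hA] at this
      refine (this.congr_deriv (by push_cast; ring)).congr_of_eventuallyEq ?_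
      filter_upwards [hev] with z hz
      exact (oscAmp_pow hm hx hz).symm
    have h2 := dE.unique h1
    have h3 : A ^ (2 * m) = A ^ (2 * m - 1) * A := by
      rw [← pow_succ]
      congr 1
      omega
    have h4 : c r * A ^ (2 * m) = E := by
      rw [hA, hE]
      exact oscAmp_pow hm hx hc0
    rw [h2, ← h4, h3]
    ring
  · have h1 : HasDerivAt (fun _ => |x₀|)
        (A * u * genSin m ψ + A * (genCos m ψ * η)) r := by
      have := dA.mul dsinψ
      simp only [Function.comp, ← hA, ← hψ] at this
      refine this.congr_of_eventuallyEq ?_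
      filter_upwards [hev] with z hz
      exact (oscAmp_mul_genSin_oscPhase hm hx hz).symm
    have h2 := h1.unique (hasDerivAt_const r _)
    have h3 : A * (u * genSin m ψ + genCos m ψ * η) = 0 := by linarith
    rcases mul_eq_zero.1 h3 with h | h
    · exact absurd h hApos.ne'
    · linarith
  · have h1 := (dsE.mul dcosψ).const_mul (x₀ / |x₀|)
    simp only [Function.comp, ← hE, ← hψ] at h1
    have h2 : p =ᶠ[𝓝 r] fun z => x₀ / |x₀| * (Real.sqrt (oscEnergy m x₀ (p z) (c z)) *
        genCos m (oscPhase m x₀ (p z) (c z))) := by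
      filter_upwards [hev] with z hz
      have hz' := Real.sqrt_pos.2 (oscEnergy_pos (p := p z) hx hz)
      rw [genCos_oscPhase hm hx hz, mul_div_cancel₀ _ hz'.ne', ← mul_assoc, ← sq, hε, one_mul]
    have h3 := hp.unique (h1.congr_of_eventuallyEq h2)
    rw [h3]
    ring
  · simp only [oscPos, if_neg hm]
    have h1 := (dA.const_mul (x₀ / |x₀|)).mul dsinθ
    simp only [Function.comp, ← hA, ← hθ] at h1
    exact h1.congr_deriv (by ring)
  · have h1 := (hc.const_mul ((m : ℝ) + 1)).mul dk
    have h2 := (dA.mul dsE).mul ((dω.mul hs).sub ((dsinθ.mul dcosθ).sub (dsinψ.mul dcosψ)))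
    have h3 : (fun r => (m + 1) * c r * oscClock m x₀ (p r) (c r) (s r)) =ᶠ[𝓝 r] fun r =>
        oscAmp m x₀ (p r) (c r) * Real.sqrt (oscEnergy m x₀ (p r) (c r)) *
        (oscFreq m x₀ (p r) (c r) * s r -
        (genSin m (oscAngle m x₀ (p r) (c r) (s r)) * genCos m (oscAngle m x₀ (p r) (c r) (s r)) -
          genSin m (oscPhase m x₀ (p r) (c r)) * genCos m (oscPhase m x₀ (p r) (c r)))) := by
      filter_upwards [hev] with z hz
      exact oscClock_eq hm hx hz (s z)
    have h4 := h1.unique (h2.congr_of_eventuallyEq h3)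
    simp only [Function.comp, ← hA, ← hθ, ← hE, ← hω, ← hψ, Pi.mul_apply, Pi.sub_apply] at h4
    have h5 : E' / (2 * Real.sqrt E) = Real.sqrt E * (E' / (2 * E)) := by
      nth_rewrite 3 [← hsq]
      field_simp
    rw [h5] at h4
    have h6 : ∀ y, genSin m y * genSin m y ^ (2 * m - 1) = genSin m y ^ (2 * m) := by
      intro y
      rw [← pow_succ']
      congr 1
      omega
    have e1 := genCos_sq_add hm θ
    have e2 := genCos_sq_add hm ψ
    have e3 := h6 θ
    have e4 := h6 ψ
    linear_combination h4 - A * Real.sqrt E * (η + ω * (s' + s r * (E' / (2 * E) - u))) * e1 +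
      A * Real.sqrt E * η * e2 +
      A * Real.sqrt E * m * (η + ω * (s' + s r * (E' / (2 * E) - u))) * e3 -
      A * Real.sqrt E * m * η * e4

/-- With exponent 0 the motion is free, and the outgoing clock coincides with the incoming one. -/
lemma osc_balance_zero_exp (hm : m = 0) (hc0 : 0 < c r)
    (hp : HasDerivAt p p' r) (hc : HasDerivAt c c' r) (hs : HasDerivAt s s' r) {k' : ℝ}
    (hk : HasDerivAt (fun r => oscClock m x₀ (p r) (c r) (s r)) k' r)
    (hx0 : HasDerivAt (fun r => oscPos m x₀ (p r) (c r) (s r)) 0 r) :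
    k' = s' ∧ oscClock m x₀ (p r) (c r) (s r) = s r ∧ p' * s r + p r * s' = 0 := by
  subst hm
  have h : ∀ z, 0 < c z → oscClock 0 x₀ (p z) (c z) (s z) = s z := by
    intro z hz
    simp only [oscClock, oscPos, oscMom, oscEnergy, if_true]
    field_simp
    simp
    ring
  refine ⟨hk.unique (hs.congr_of_eventuallyEq ?_), h r hc0, ?_⟩
  · filter_upwards [hc.continuousAt.eventually (lt_mem_nhds hc0)] with z hz
    exact h z hz
  · simp only [oscPos, if_true] at hx0
    exact ((hp.mul hs).const_add x₀).unique hx0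

/-- If the endpoints are fixed, the variation of the action balances across a level. -/
lemma osc_balance (hx : m ≠ 0 → x₀ ≠ 0) (hc0 : 0 < c r)
    (hp : HasDerivAt p p' r) (hc : HasDerivAt c c' r) (hs : HasDerivAt s s' r) {k' E' : ℝ}
    (hE : HasDerivAt (fun r => oscEnergy m x₀ (p r) (c r)) E' r)
    (hk : HasDerivAt (fun r => oscClock m x₀ (p r) (c r) (s r)) k' r)
    (hx0 : HasDerivAt (fun r => oscPos m x₀ (p r) (c r) (s r)) 0 r) :
    2 * c r * k' + oscClock m x₀ (p r) (c r) (s r) * c' =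
      2 * oscEnergy m x₀ (p r) (c r) * s' + s r * E' := by
  have hE2 := hE.unique (hasDerivAt_oscEnergy_param hp hc)
  by_cases hm : m = 0
  · obtain ⟨h1, h2, h3⟩ := osc_balance_zero_exp hm hc0 hp hc hs hk hx0
    rw [h1, h2, hE2, oscEnergy, hm]
    linear_combination (-2 * p r) * h3
  · obtain ⟨u, η, θ', k, h1, h2, -, h4, h5, h6, h7⟩ :=
      exists_osc_variation hm hx hc0 hp hc hs rfl rfl rfl rfl rfl hE2
    obtain rfl := hk.unique h6
    have hEpos := oscEnergy_pos (p := p r) hx hc0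
    have hApos := oscAmp_pos (p := p r) hx hc0
    have h8 := oscClock_eq (p := p r) hm hx hc0 (s r)
    have e1 := genCos_sq_add hm (oscAngle m x₀ (p r) (c r) (s r))
    have e2 := genCos_sq_add hm (oscPhase m x₀ (p r) (c r))
    have h9 : oscAmp m x₀ (p r) (c r) * Real.sqrt (oscEnergy m x₀ (p r) (c r)) *
        oscFreq m x₀ (p r) (c r) = oscEnergy m x₀ (p r) (c r) := by
      rw [oscFreq, mul_assoc, mul_div_assoc', Real.mul_self_sqrt hEpos.le]
      field_simp
    have h10 := h5.unique hx0
    have h11 : genSin m (oscAngle m x₀ (p r) (c r) (s r)) * u +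
        genCos m (oscAngle m x₀ (p r) (c r) (s r)) * θ' = 0 := by
      have hε : x₀ / |x₀| ≠ 0 := div_ne_zero (hx hm) (abs_pos.2 (hx hm)).ne'
      exact (mul_eq_zero.1 h10).resolve_left (mul_ne_zero hε hApos.ne')
    set A := oscAmp m x₀ (p r) (c r)
    set E := oscEnergy m x₀ (p r) (c r)
    set ω := oscFreq m x₀ (p r) (c r)
    set ψ := oscPhase m x₀ (p r) (c r)
    set θ := oscAngle m x₀ (p r) (c r) (s r)
    set K := oscClock m x₀ (p r) (c r) (s r)
    -- `e` is half the logarithmic derivative of the energy, i.e. the logarithmic derivative of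
    -- `√E`.
    obtain ⟨e, rfl⟩ : ∃ e, E' = 2 * E * e := ⟨E' / (2 * E), by field_simp⟩
    rw [show 2 * E * e / (2 * E) = e by field_simp] at h4 h7
    -- Write `sin^(2m) = 1 - cos²` and use the fixed final and initial positions to trade `cos θ θ'`
    -- for `-sin θ u` and `cos ψ η` for `-sin ψ u`.
    have hs1 : genSin m θ ^ (2 * m) * θ' = θ' + genSin m θ * genCos m θ * u := by
      linear_combination θ' * e1 - genCos m θ * h11
    have hs2 : genSin m ψ ^ (2 * m) * η = η + genSin m ψ * genCos m ψ * u := by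
      linear_combination η * e2 - genCos m ψ * h2
    rw [hs1, hs2, h4] at h7
    have h12 : 2 * (c r) * e = c' + 2 * m * u * c r :=
      mul_left_cancel₀ hEpos.ne' (by linear_combination h1)
    have hm1 : (m : ℝ) + 1 ≠ 0 := by positivity
    refine mul_left_cancel₀ hm1 ?_
    linear_combination 2 * h7 + (2 * (m + 1) * (s' + s r * e)) * h9 -
      (2 * (e - m * u)) * h8 + (m + 1) * K * h12

/-- Away from focal points, a variation fixing the endpoints and balancing energy against
duration only rescales the oscillator. -/
lemma osc_rigid (hx : m ≠ 0 → x₀ ≠ 0) (hc0 : 0 < c r)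
    (hp : HasDerivAt p p' r) (hc : HasDerivAt c c' r) (hs : HasDerivAt s s' r) {k' E' : ℝ}
    (hE : HasDerivAt (fun r => oscEnergy m x₀ (p r) (c r)) E' r)
    (hk : HasDerivAt (fun r => oscClock m x₀ (p r) (c r) (s r)) k' r)
    (hx0 : HasDerivAt (fun r => oscPos m x₀ (p r) (c r) (s r)) 0 r)
    (hs' : s' = 0) (hE0 : E' = 0) (hs0 : s r ≠ 0)
    (hf : m ≠ 0 → focal m (oscPhase m x₀ (p r) (c r)) (oscAngle m x₀ (p r) (c r) (s r)) ≠ 0) :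
    p' = 0 ∧ c' = 0 ∧ k' = 0 := by
  have hb := osc_balance hx hc0 hp hc hs hE hk hx0
  have hE2 := hE.unique (hasDerivAt_oscEnergy_param hp hc)
  subst hs'
  have hpc : p' = 0 ∧ c' = 0 := by
    by_cases hm : m = 0
    · obtain ⟨h1, h2, h3⟩ := osc_balance_zero_exp hm hc0 hp hc hs hk hx0
      have h4 : p' = 0 := by simpa [hs0] using h3
      rw [hE0, h4, hm] at hE2
      exact ⟨h4, by simpa using hE2.symm⟩
    · obtain ⟨u, η, θ', k, h1, h2, h3, h4, h5, -, -⟩ :=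
        exists_osc_variation hm hx hc0 hp hc hs rfl rfl rfl rfl rfl hE2
      have hEpos := oscEnergy_pos (p := p r) hx hc0
      have hApos := oscAmp_pos (p := p r) hx hc0
      have h10 := h5.unique hx0
      have h11 : genSin m (oscAngle m x₀ (p r) (c r) (s r)) * u +
          genCos m (oscAngle m x₀ (p r) (c r) (s r)) * θ' = 0 := by
        have hε : x₀ / |x₀| ≠ 0 := div_ne_zero (hx hm) (abs_pos.2 (hx hm)).ne'
        exact (mul_eq_zero.1 h10).resolve_left (mul_ne_zero hε hApos.ne')
      have hf := hf hm
      have hθ : oscAngle m x₀ (p r) (c r) (s r) - oscPhase m x₀ (p r) (c r) =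
          oscFreq m x₀ (p r) (c r) * s r := by
        rw [oscAngle]
        ring
      rw [hE0, zero_div, zero_add, zero_sub] at h4
      -- Fixed initial and final positions read `sin ψ u + cos ψ η = 0` and `(sin θ - (θ-ψ) cos θ) u
      -- + cos θ η = 0`. The determinant of this system is `focal` up to sign, and Cramer's rule
      -- eliminates `η` here and `u` below.
      have hu : u = 0 := by
        refine (mul_eq_zero.1 ?_).resolve_left hf
        rw [focal, hθ]
        rw [h4] at h11
        linear_combination genCos m (oscPhase m x₀ (p r) (c r)) * h11 -
          genCos m (oscAngle m x₀ (p r) (c r) (s r)) * h2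
      rw [hu, hE0] at h1
      have hc' : c' = 0 := by
        have : oscEnergy m x₀ (p r) (c r) * c' = 0 := by linear_combination -h1
        exact (mul_eq_zero.1 this).resolve_left hEpos.ne'
      have hη : η = 0 := by
        refine (mul_eq_zero.1 ?_).resolve_left hf
        rw [focal]
        rw [h4, hu] at h11
        rw [hu] at h2
        linear_combination (genSin m (oscAngle m x₀ (p r) (c r) (s r)) -
          (oscAngle m x₀ (p r) (c r) (s r) - oscPhase m x₀ (p r) (c r)) *
          genCos m (oscAngle m x₀ (p r) (c r) (s r))) * h2 -
          genSin m (oscPhase m x₀ (p r) (c r)) * h11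
      rw [hη, hE0] at h3
      exact ⟨by simpa using h3, hc'⟩
  refine ⟨hpc.1, hpc.2, ?_⟩
  rw [hpc.2, hE0] at hb
  simpa [hc0.ne'] using hb

/-- After half a period an oscillator released at rest is focused to first order. -/
lemma osc_focus (hm : m ≠ 0) (hx : m ≠ 0 → x₀ ≠ 0) (hc0 : 0 < c r)
    (hp : HasDerivAt p p' r) (hc : HasDerivAt c 0 r) (hs : HasDerivAt s 0 r) (hp0 : p r = 0)
    (hπ : oscFreq m x₀ (p r) (c r) * s r = genPi m) :
    HasDerivAt (fun r => oscPos m x₀ (p r) (c r) (s r)) 0 r ∧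
      HasDerivAt (fun r => oscClock m x₀ (p r) (c r) (s r)) 0 r := by
  obtain ⟨u, η, θ', k, h1, h2, -, h4, h5, h6, h7⟩ :=
    exists_osc_variation hm hx hc0 hp hc hs rfl rfl rfl rfl rfl rfl
  have hEpos := oscEnergy_pos (p := p r) hx hc0
  have hApos := oscAmp_pos (p := p r) hx hc0
  have hcos : genCos m (oscPhase m x₀ (p r) (c r)) = 0 := by
    rw [genCos_oscPhase hm hx hc0, hp0]
    simp
  have hcos2 : genCos m (oscAngle m x₀ (p r) (c r) (s r)) = 0 := by
    rw [oscAngle, hπ, genCos_add_pi hm, hcos, neg_zero]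
  have hsin2 : genSin m (oscAngle m x₀ (p r) (c r) (s r)) ^ (2 * m) =
      genSin m (oscPhase m x₀ (p r) (c r)) ^ (2 * m) := by
    rw [oscAngle, hπ, genSin_add_pi hm, (even_two_mul m).neg_pow]
  have hsin : genSin m (oscPhase m x₀ (p r) (c r)) ≠ 0 :=
    (genSin_pos hm (oscPhase_mem hm hx hc0)).ne'
  -- At rest `cos ψ = 0`, so the fixed initial position forces the amplitude to be stationary.
  have hu : u = 0 := by
    rw [hcos, zero_mul, eq_comm, neg_eq_zero] at h2
    exact (mul_eq_zero.1 h2).resolve_left hsin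
  have hθ : θ' = η := by
    rw [h4, hu, hp0]
    simp
  refine ⟨?_, ?_⟩
  · rw [hcos2, hu] at h5
    simpa using h5
  -- Both ends of the arc shift in phase by the same amount and `sin^(2m)` agrees there, so the gain
  -- at one end cancels the loss at the other.
  · rw [hsin2, hθ, hu, hp0] at h7
    have hk : k = 0 := by
      have hm1 : (m : ℝ) + 1 ≠ 0 := by positivity
      simpa [hm1, hc0.ne'] using h7
    rwa [hk] at h6

/-- The chain rule for the levels whose data do not vary to first order, via joint differentiability
in momentum, coefficient and duration. -/
lemma osc_const (hx : m ≠ 0 → x₀ ≠ 0) (hc0 : 0 < c r)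
    (hp : HasDerivAt p 0 r) (hc : HasDerivAt c 0 r) (hs : HasDerivAt s 0 r) :
    HasDerivAt (fun r => oscPos m x₀ (p r) (c r) (s r)) 0 r ∧
      HasDerivAt (fun r => oscClock m x₀ (p r) (c r) (s r)) 0 r := by
  have hcurve : HasDerivAt (fun r => ((p r, c r, s r) : ℝ × ℝ × ℝ)) 0 r :=
    hp.prodMk (hc.prodMk hs)
  have d1 : DifferentiableAt ℝ (fun w : ℝ × ℝ × ℝ => oscPos m x₀ w.1 w.2.1 w.2.2)
      (p r, c r, s r) :=
    differentiableAt_oscPos hx hc0 (by fun_prop) (by fun_prop) (by fun_prop)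
  have d2 : DifferentiableAt ℝ (fun w : ℝ × ℝ × ℝ => oscClock m x₀ w.1 w.2.1 w.2.2)
      (p r, c r, s r) :=
    differentiableAt_oscClock hx hc0 (by fun_prop) (by fun_prop) (by fun_prop)
  have e1 := d1.hasFDerivAt.comp_hasDerivAt r hcurve
  have e2 := d2.hasFDerivAt.comp_hasDerivAt r hcurve
  rw [map_zero] at e1 e2
  exact ⟨e1, e2⟩

end Variation

/-! ### Hamilton's equations -/

section Hamilton

variable {n : ℕ} {α : Fin n → ℕ}

/-- The nested energies `h_{n+1} = p_{n+1}²`, `h_k = p_k² + h_{k+1} x_k^{2α_k}`. -/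
def nest (α : Fin n → ℕ) (x p : Fin (n + 1) → ℝ) : Fin (n + 1) → ℝ :=
  Fin.reverseInduction (motive := fun _ => ℝ) (p (Fin.last n) ^ 2)
    fun i h => oscEnergy (α i) (x i.castSucc) (p i.castSucc) h

@[simp] lemma nest_last (x p : Fin (n + 1) → ℝ) :
    nest α x p (Fin.last n) = p (Fin.last n) ^ 2 := by
  simp [nest]

lemma nest_castSucc (x p : Fin (n + 1) → ℝ) (i : Fin n) :
    nest α x p i.castSucc =
      oscEnergy (α i) (x i.castSucc) (p i.castSucc) (nest α x p i.succ) := by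
  simp [nest]

@[simp] lemma xi_zero (x : Fin (n + 1) → ℝ) : xi α 0 x = 1 := by
  simp [xi]

lemma xi_succ (x : Fin (n + 1) → ℝ) (i : Fin n) :
    xi α i.succ x = xi α i.castSucc x * x i.castSucc ^ α i := by
  have h : (Finset.univ.filter fun k : Fin n => k.castSucc < i.succ) =
      insert i (Finset.univ.filter fun k : Fin n => k.castSucc < i.castSucc) := by
    ext k
    simp only [Finset.mem_filter, Finset.mem_univ, true_and, Finset.mem_insert, Fin.lt_def,
      Fin.val_castSucc, Fin.val_succ, Fin.ext_iff]
    omega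
  rw [xi, h, Finset.prod_insert (by simp), mul_comm, xi]

lemma xi_congr {x y : Fin (n + 1) → ℝ} {j : Fin (n + 1)}
    (h : ∀ i : Fin n, i.castSucc < j → x i.castSucc = y i.castSucc) : xi α j x = xi α j y := by
  refine Finset.prod_congr rfl fun i hi => ?_
  rw [h i (by simpa using hi)]

lemma nest_congr {x y p q : Fin (n + 1) → ℝ} (k : Fin (n + 1))
    (hx : ∀ j, k ≤ j → x j = y j) (hp : ∀ j, k ≤ j → p j = q j) :
    nest α x p k = nest α y q k := by
  induction k using Fin.reverseInduction with
  | last => simp [hp _ le_rfl]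
  | cast i ih =>
    have hle : i.castSucc ≤ i.succ := Fin.castSucc_lt_succ.le
    rw [nest_castSucc, nest_castSucc, hx _ le_rfl, hp _ le_rfl,
      ih (fun j hj => hx j (hle.trans hj)) (fun j hj => hp j (hle.trans hj))]

lemma nest_pos {x p : Fin (n + 1) → ℝ} (hx : ∀ i, α i ≠ 0 → x i.castSucc ≠ 0)
    (hp : p (Fin.last n) ≠ 0) (k : Fin (n + 1)) : 0 < nest α x p k := by
  induction k using Fin.reverseInduction with
  | last => simp only [nest_last]; positivity
  | cast i ih =>
    rw [nest_castSucc]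
    exact oscEnergy_pos (hx i) ih

lemma hamiltonian_eq_sum (x p : Fin (n + 1) → ℝ) :
    hamiltonian α x p = (1 / 2) * ∑ j, (p j * xi α j x) ^ 2 := by
  simp only [hamiltonian, vectorField]
  congr 1
  refine Finset.sum_congr rfl fun j _ => ?_
  rw [Finset.sum_eq_single j]
  · simp
  · intro i _ hij
    simp [hij]
  · simp

/-- Cutting the sum at level `k + 1` isolates `x_k`: neither the partial sum nor `h_{k+1}` contains
it, so it enters only through the factor `ξ_{k+1}²`. This gives the position gradient. -/
lemma two_mul_hamiltonian (x p : Fin (n + 1) → ℝ) (k : Fin (n + 1)) :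
    2 * hamiltonian α x p = ∑ j with j < k, (p j * xi α j x) ^ 2 + xi α k x ^ 2 * nest α x p k := by
  induction k using Fin.reverseInduction with
  | last =>
    rw [hamiltonian_eq_sum, nest_last]
    have h : (Finset.univ : Finset (Fin (n + 1))) =
        insert (Fin.last n) (Finset.univ.filter fun j => j < Fin.last n) := by
      ext j
      simp [Fin.lt_last_iff_ne_last, em]
    nth_rewrite 1 [h]
    rw [Finset.sum_insert (by simp)]
    ring
  | cast i ih =>
    rw [ih]
    have h : (Finset.univ.filter fun j : Fin (n + 1) => j < i.succ) =
        insert i.castSucc (Finset.univ.filter fun j => j < i.castSucc) := by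
      ext k
      simp only [Finset.mem_filter, Finset.mem_univ, true_and, Finset.mem_insert, Fin.lt_def,
        Fin.val_castSucc, Fin.val_succ, Fin.ext_iff]
      omega
    rw [h, Finset.sum_insert (by simp), nest_castSucc, oscEnergy, xi_succ]
    ring

lemma hasDerivAt_hamiltonian_mom (x p : Fin (n + 1) → ℝ) (j : Fin (n + 1)) :
    HasDerivAt (fun q => hamiltonian α x (Function.update p j q)) (xi α j x ^ 2 * p j) (p j) := by
  have h : (fun q => hamiltonian α x (Function.update p j q)) = fun q =>
      (1 / 2) * ((q * xi α j x) ^ 2 + ∑ k ∈ Finset.univ.erase j, (p k * xi α k x) ^ 2) := by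
    ext q
    rw [hamiltonian_eq_sum, ← Finset.add_sum_erase _ _ (Finset.mem_univ j),
      Function.update_self]
    congr 2
    refine Finset.sum_congr rfl fun k hk => ?_
    rw [Function.update_of_ne (Finset.ne_of_mem_erase hk)]
  rw [h]
  refine (((((hasDerivAt_id' (p j)).mul_const _).pow 2).add_const _).const_mul _).congr_deriv ?_
  simp
  ring

/-- The derivative of the Hamiltonian in the position. -/
def gradPos (α : Fin n → ℕ) (x p : Fin (n + 1) → ℝ) : Fin (n + 1) → ℝ :=
  Fin.lastCases (motive := fun _ => ℝ) 0 fun i =>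
    α i * (xi α i.castSucc x ^ 2 * nest α x p i.succ) * x i.castSucc ^ (2 * α i - 1)

lemma hasDerivAt_hamiltonian_pos (x p : Fin (n + 1) → ℝ) (j : Fin (n + 1)) :
    HasDerivAt (fun y => hamiltonian α (Function.update x j y) p) (gradPos α x p j) (x j) := by
  induction j using Fin.lastCases with
  | last =>
    have h : (fun y => hamiltonian α (Function.update x (Fin.last n) y) p) =
        fun _ => hamiltonian α x p := by
      ext y
      rw [hamiltonian_eq_sum, hamiltonian_eq_sum]
      congr 1
      refine Finset.sum_congr rfl fun k _ => ?_
      rw [xi_congr (y := x)]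
      intro i _
      rw [Function.update_of_ne (Fin.castSucc_lt_last i).ne]
    rw [h]
    simpa [gradPos] using hasDerivAt_const (x (Fin.last n)) (hamiltonian α x p)
  | cast i =>
    have h : (fun y => hamiltonian α (Function.update x i.castSucc y) p) = fun y =>
        (1 / 2) * (∑ j with j < i.succ, (p j * xi α j x) ^ 2 +
          (xi α i.castSucc x * y ^ α i) ^ 2 * nest α x p i.succ) := by
      ext y
      have h1 := two_mul_hamiltonian (α := α) (Function.update x i.castSucc y) p i.succ
      have hxi : ∀ j : Fin (n + 1), j ≤ i.castSucc →
          xi α j (Function.update x i.castSucc y) = xi α j x := by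
        intro j hj
        refine xi_congr fun k hk => ?_
        rw [Function.update_of_ne (hk.trans_le hj).ne]
      rw [xi_succ, hxi _ le_rfl, Function.update_self,
        nest_congr (α := α) (y := x) (q := p) i.succ
          (fun j hj => Function.update_of_ne (Fin.castSucc_lt_succ.trans_le hj).ne' _ _)
          (fun _ _ => rfl)] at h1
      have h2 : hamiltonian α (Function.update x i.castSucc y) p = (1 / 2) *
          (2 * hamiltonian α (Function.update x i.castSucc y) p) := by ring
      rw [h2, h1]
      congr 2
      refine Finset.sum_congr rfl fun k hk => ?_
      rw [hxi]
      simp only [Finset.mem_filter, Finset.mem_univ, true_and, Fin.lt_def, Fin.val_succ] at hk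
      simp only [Fin.le_def, Fin.val_castSucc]
      omega
    rw [h]
    refine (((((((hasDerivAt_id' (x i.castSucc)).pow (α i)).const_mul _).pow 2).mul_const
      _).const_add _).const_mul _).congr_deriv ?_
    simp only [gradPos, Fin.lastCases_castSucc, Pi.pow_apply]
    by_cases hα : α i = 0
    · simp [hα]
    · obtain ⟨k, hk⟩ := Nat.exists_eq_succ_of_ne_zero hα
      rw [hk, show 2 * k.succ - 1 = k + (k + 1) by omega, pow_add]
      simp
      ring

lemma isExtremal_iff {x p : ℝ → Fin (n + 1) → ℝ} :
    IsExtremal α x p ↔ ∀ (t : ℝ) (j : Fin (n + 1)),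
      HasDerivAt (fun s => x s j) (xi α j (x t) ^ 2 * p t j) t ∧
      HasDerivAt (fun s => p s j) (-gradPos α (x t) (p t) j) t := by
  simp only [IsExtremal, (hasDerivAt_hamiltonian_mom _ _ _).deriv,
    (hasDerivAt_hamiltonian_pos _ _ _).deriv]

lemma contDiff_xi (j : Fin (n + 1)) : ContDiff ℝ 1 (xi α j) := by
  unfold xi
  exact contDiff_prod fun i _ => (contDiff_apply ℝ ℝ i.castSucc).pow _

lemma contDiff_nest (k : Fin (n + 1)) :
    ContDiff ℝ 1 (fun z : (Fin (n + 1) → ℝ) × (Fin (n + 1) → ℝ) => nest α z.1 z.2 k) := by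
  induction k using Fin.reverseInduction with
  | last => simp only [nest_last]; fun_prop
  | cast i ih =>
    simp only [nest_castSucc, oscEnergy]
    fun_prop

/-- The Hamiltonian vector field. -/
def hamField (α : Fin n → ℕ) (z : (Fin (n + 1) → ℝ) × (Fin (n + 1) → ℝ)) :
    (Fin (n + 1) → ℝ) × (Fin (n + 1) → ℝ) :=
  (fun j => xi α j z.1 ^ 2 * z.2 j, fun j => -gradPos α z.1 z.2 j)

lemma contDiff_hamField : ContDiff ℝ 1 (hamField α) := by
  have hxi : ∀ j, ContDiff ℝ 1
      (fun z : (Fin (n + 1) → ℝ) × (Fin (n + 1) → ℝ) => xi α j z.1) :=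
    fun j => (contDiff_xi j).comp contDiff_fst
  refine ContDiff.prodMk (contDiff_pi.2 fun j => ?_) (contDiff_pi.2 fun j => ?_)
  · have := hxi j
    fun_prop
  · induction j using Fin.lastCases with
    | last => simpa [gradPos] using contDiff_const
    | cast i =>
      simp only [gradPos, Fin.lastCases_castSucc]
      have := hxi i.castSucc
      have := contDiff_nest (α := α) i.succ
      fun_prop

lemma IsExtremal.hasDerivAt {x p : ℝ → Fin (n + 1) → ℝ} (h : IsExtremal α x p) (t : ℝ) :
    HasDerivAt (fun s => (x s, p s)) (hamField α (x t, p t)) t := by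
  rw [isExtremal_iff] at h
  exact (hasDerivAt_pi.2 fun j => (h t j).1).prodMk (hasDerivAt_pi.2 fun j => (h t j).2)

/-- The Hamiltonian field is `C¹`, hence Lipschitz on a compact set containing both trajectories
over a bounded time interval. Uniqueness is needed because `geodesic` is defined by choice. -/
lemma IsExtremal.unique {x p y q : ℝ → Fin (n + 1) → ℝ} (h : IsExtremal α x p)
    (h' : IsExtremal α y q) (hx : x 0 = y 0) (hp : p 0 = q 0) (t : ℝ) : x t = y t := by
  set f := fun s => (x s, p s)
  set g := fun s => (y s, q s)
  have hf : Continuous f := continuous_iff_continuousAt.2 fun t => (h.hasDerivAt t).continuousAt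
  have hg : Continuous g := continuous_iff_continuousAt.2 fun t => (h'.hasDerivAt t).continuousAt
  set T := |t| + 1
  have hT : 0 < T := by positivity
  set K := f '' Icc (-T) T ∪ g '' Icc (-T) T
  have hK : IsCompact K := (isCompact_Icc.image hf).union (isCompact_Icc.image hg)
  obtain ⟨C, hC⟩ := LocallyLipschitzOn.exists_lipschitzOnWith_of_compact hK
    ((contDiff_hamField (α := α)).locallyLipschitz.locallyLipschitzOn (s := K))
  have := ODE_solution_unique_of_mem_Ioo (v := fun _ => hamField α) (s := fun _ => K) (K := C)
    (f := f) (g := g) (a := -T) (b := T) (t₀ := 0) (fun _ _ => hC) ⟨by linarith, hT⟩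
    (fun s hs => ⟨h.hasDerivAt s, Or.inl (mem_image_of_mem _ (Ioo_subset_Icc_self hs))⟩)
    (fun s hs => ⟨h'.hasDerivAt s, Or.inr (mem_image_of_mem _ (Ioo_subset_Icc_self hs))⟩)
    (Prod.ext hx hp)
  have ht : t ∈ Ioo (-T) T := abs_lt.1 (lt_add_one |t|)
  exact congrArg Prod.fst (this ht)

/-! ### The explicit flow -/

/-- The clocks: `s_1 = t`, and `s_{k+1}` is the integral of `x_k^{2α_k}` with respect to `s_k`. -/
def clock (α : Fin n → ℕ) (x₀ v : Fin (n + 1) → ℝ) (t : ℝ) : Fin (n + 1) → ℝ :=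
  Fin.induction (motive := fun _ => ℝ) t fun i s =>
    oscClock (α i) (x₀ i.castSucc) (v i.castSucc) (nest α x₀ v i.succ) s

@[simp] lemma clock_zero (x₀ v : Fin (n + 1) → ℝ) (t : ℝ) : clock α x₀ v t 0 = t := rfl

lemma clock_succ (x₀ v : Fin (n + 1) → ℝ) (t : ℝ) (i : Fin n) :
    clock α x₀ v t i.succ = oscClock (α i) (x₀ i.castSucc) (v i.castSucc) (nest α x₀ v i.succ)
      (clock α x₀ v t i.castSucc) := rfl

/-- The position along the extremal with initial data `(x₀, v)`. -/
def flowPos (α : Fin n → ℕ) (x₀ v : Fin (n + 1) → ℝ) (t : ℝ) : Fin (n + 1) → ℝ :=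
  Fin.lastCases (motive := fun _ => ℝ)
    (x₀ (Fin.last n) + v (Fin.last n) * clock α x₀ v t (Fin.last n)) fun i =>
    oscPos (α i) (x₀ i.castSucc) (v i.castSucc) (nest α x₀ v i.succ) (clock α x₀ v t i.castSucc)

/-- The momentum along the extremal with initial data `(x₀, v)`. -/
def flowMom (α : Fin n → ℕ) (x₀ v : Fin (n + 1) → ℝ) (t : ℝ) : Fin (n + 1) → ℝ :=
  Fin.lastCases (motive := fun _ => ℝ) (v (Fin.last n)) fun i =>
    oscMom (α i) (x₀ i.castSucc) (v i.castSucc) (nest α x₀ v i.succ) (clock α x₀ v t i.castSucc)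

@[simp] lemma flowPos_last (x₀ v : Fin (n + 1) → ℝ) (t : ℝ) : flowPos α x₀ v t (Fin.last n) =
    x₀ (Fin.last n) + v (Fin.last n) * clock α x₀ v t (Fin.last n) := by
  simp [flowPos]

@[simp] lemma flowPos_castSucc (x₀ v : Fin (n + 1) → ℝ) (t : ℝ) (i : Fin n) :
    flowPos α x₀ v t i.castSucc = oscPos (α i) (x₀ i.castSucc) (v i.castSucc)
      (nest α x₀ v i.succ) (clock α x₀ v t i.castSucc) := by
  simp [flowPos]

@[simp] lemma flowMom_last (x₀ v : Fin (n + 1) → ℝ) (t : ℝ) :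
    flowMom α x₀ v t (Fin.last n) = v (Fin.last n) := by
  simp [flowMom]

@[simp] lemma flowMom_castSucc (x₀ v : Fin (n + 1) → ℝ) (t : ℝ) (i : Fin n) :
    flowMom α x₀ v t i.castSucc = oscMom (α i) (x₀ i.castSucc) (v i.castSucc)
      (nest α x₀ v i.succ) (clock α x₀ v t i.castSucc) := by
  simp [flowMom]

variable {x₀ v : Fin (n + 1) → ℝ}

/-- Every nested energy is conserved by the explicit curve, so the coefficient frozen at time 0 in
each oscillator is the one that Hamilton's equations require at time `t`. -/
lemma nest_flow (hx : ∀ i, α i ≠ 0 → x₀ i.castSucc ≠ 0) (hv : v (Fin.last n) ≠ 0) (t : ℝ)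
    (k : Fin (n + 1)) : nest α (flowPos α x₀ v t) (flowMom α x₀ v t) k = nest α x₀ v k := by
  induction k using Fin.reverseInduction with
  | last => simp
  | cast i ih =>
    rw [nest_castSucc, ih, nest_castSucc (x := x₀), flowPos_castSucc, flowMom_castSucc, oscEnergy]
    exact oscMom_sq_add (hx i) (nest_pos hx hv _) _

/-- The chain rule along `ξ_{k+1}² = ξ_k² x_k^(2α_k)`. Hence the clocks are the integrals that
define the times `τ_j`. -/
lemma hasDerivAt_clock (hx : ∀ i, α i ≠ 0 → x₀ i.castSucc ≠ 0) (hv : v (Fin.last n) ≠ 0) (t : ℝ)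
    (k : Fin (n + 1)) :
    HasDerivAt (fun t => clock α x₀ v t k) (xi α k (flowPos α x₀ v t) ^ 2) t := by
  induction k using Fin.induction with
  | zero => simpa using hasDerivAt_id' t
  | succ i ih =>
    simp only [clock_succ]
    have := (hasDerivAt_oscClock (hx i) (nest_pos hx hv i.succ) _).comp t ih
      (h₂ := fun s => oscClock (α i) (x₀ i.castSucc) (v i.castSucc) (nest α x₀ v i.succ) s)
    refine this.congr_deriv ?_
    rw [xi_succ, flowPos_castSucc]
    ring

lemma clock_time_zero (hx : ∀ i, α i ≠ 0 → x₀ i.castSucc ≠ 0) (hv : v (Fin.last n) ≠ 0)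
    (k : Fin (n + 1)) : clock α x₀ v 0 k = 0 := by
  induction k using Fin.induction with
  | zero => simp
  | succ i ih => rw [clock_succ, ih, oscClock_zero (hx i) (nest_pos hx hv i.succ)]

lemma clock_strictMono (hx : ∀ i, α i ≠ 0 → x₀ i.castSucc ≠ 0) (hv : v (Fin.last n) ≠ 0)
    (k : Fin (n + 1)) : StrictMono fun t => clock α x₀ v t k := by
  induction k using Fin.induction with
  | zero => exact strictMono_id
  | succ i ih => exact (oscClock_strictMono (hx i) (nest_pos hx hv i.succ)).comp ih

lemma clock_tendsto (hx : ∀ i, α i ≠ 0 → x₀ i.castSucc ≠ 0) (hv : v (Fin.last n) ≠ 0)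
    (k : Fin (n + 1)) : Tendsto (fun t => clock α x₀ v t k) atTop atTop := by
  induction k using Fin.induction with
  | zero => exact tendsto_id
  | succ i ih => exact (oscClock_tendsto (hx i) (nest_pos hx hv i.succ)).comp ih

lemma clock_continuous (hx : ∀ i, α i ≠ 0 → x₀ i.castSucc ≠ 0) (hv : v (Fin.last n) ≠ 0)
    (k : Fin (n + 1)) : Continuous fun t => clock α x₀ v t k :=
  continuous_iff_continuousAt.2 fun t => (hasDerivAt_clock hx hv t k).continuousAt

lemma isExtremal_flow (hx : ∀ i, α i ≠ 0 → x₀ i.castSucc ≠ 0) (hv : v (Fin.last n) ≠ 0) :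
    IsExtremal α (flowPos α x₀ v) (flowMom α x₀ v) := by
  rw [isExtremal_iff]
  intro t j
  induction j using Fin.lastCases with
  | last =>
    simp only [flowPos_last, flowMom_last, gradPos, Fin.lastCases_last, neg_zero]
    refine ⟨?_, hasDerivAt_const _ _⟩
    exact (((hasDerivAt_clock hx hv t _).const_mul _).const_add _).congr_deriv (mul_comm _ _)
  | cast i =>
    have hc := nest_pos (α := α) hx hv i.succ
    have hs := hasDerivAt_clock (α := α) hx hv t i.castSucc
    simp only [gradPos, Fin.lastCases_castSucc, nest_flow hx hv]
    simp only [flowPos_castSucc, flowMom_castSucc]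
    refine ⟨?_, ?_⟩
    · exact ((hasDerivAt_oscPos (hx i) hc _).comp t hs
        (h₂ := fun s => oscPos (α i) (x₀ i.castSucc) (v i.castSucc) (nest α x₀ v i.succ) s)
        ).congr_deriv (mul_comm _ _)
    · exact ((hasDerivAt_oscMom (hx i) hc _).comp t hs
        (h₂ := fun s => oscMom (α i) (x₀ i.castSucc) (v i.castSucc) (nest α x₀ v i.succ) s)
        ).congr_deriv (by ring)

lemma flowPos_time_zero (hx : ∀ i, α i ≠ 0 → x₀ i.castSucc ≠ 0) (hv : v (Fin.last n) ≠ 0) :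
    flowPos α x₀ v 0 = x₀ := by
  ext j
  induction j using Fin.lastCases with
  | last => simp [clock_time_zero hx hv]
  | cast i =>
    rw [flowPos_castSucc, clock_time_zero hx hv, oscPos_zero (hx i) (nest_pos hx hv i.succ)]

lemma flowMom_time_zero (hx : ∀ i, α i ≠ 0 → x₀ i.castSucc ≠ 0) (hv : v (Fin.last n) ≠ 0) :
    flowMom α x₀ v 0 = v := by
  ext j
  induction j using Fin.lastCases with
  | last => simp
  | cast i =>
    rw [flowMom_castSucc, clock_time_zero hx hv, oscMom_zero (hx i) (nest_pos hx hv i.succ)]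

lemma geodesic_eq_flowPos (hx : ∀ i, α i ≠ 0 → x₀ i.castSucc ≠ 0) (hv : v (Fin.last n) ≠ 0) :
    geodesic α x₀ v = flowPos α x₀ v := by
  have hex : ∃ x p, IsExtremal α x p ∧ x 0 = x₀ ∧ p 0 = v :=
    ⟨_, _, isExtremal_flow hx hv, flowPos_time_zero hx hv, flowMom_time_zero hx hv⟩
  rw [geodesic, dif_pos hex]
  obtain ⟨p, h1, h2, h3⟩ := hex.choose_spec
  ext1 t
  exact h1.unique (isExtremal_flow hx hv) (h2.trans (flowPos_time_zero hx hv).symm)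
    (h3.trans (flowMom_time_zero hx hv).symm) t

lemma nest_smul (t : ℝ) (k : Fin (n + 1)) : nest α x₀ (t • v) k = t ^ 2 * nest α x₀ v k := by
  induction k using Fin.reverseInduction with
  | last => simp [mul_pow]
  | cast i ih =>
    rw [nest_castSucc, ih, Pi.smul_apply, smul_eq_mul, oscEnergy_scale, nest_castSucc]

/-- Together with `nest_smul`, this turns the time-one data of the covector `t • v` into data along
the geodesic of `v` at time `t`. -/
lemma clock_smul {t : ℝ} (ht : 0 < t) (k : Fin (n + 1)) :
    t * clock α x₀ (t • v) 1 k = clock α x₀ v t k := by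
  induction k using Fin.induction with
  | zero => simp
  | succ i ih =>
    rw [clock_succ, clock_succ, nest_smul, Pi.smul_apply, smul_eq_mul, oscClock_scale ht, ih]

end Hamilton

/-! ### Critical points of the exponential map -/

section Exp

variable {n : ℕ} {α : Fin n → ℕ} {x₀ v : Fin (n + 1) → ℝ}

lemma clock_pos (hx : ∀ i, α i ≠ 0 → x₀ i.castSucc ≠ 0) (hv : v (Fin.last n) ≠ 0) {t : ℝ}
    (ht : 0 < t) (k : Fin (n + 1)) : 0 < clock α x₀ v t k := by
  have := clock_strictMono hx hv k ht
  simpa only [clock_time_zero hx hv] using this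

lemma differentiable_nest (k : Fin (n + 1)) : Differentiable ℝ fun w => nest α x₀ w k :=
  ((contDiff_nest k).comp (contDiff_const.prodMk contDiff_id)).differentiable one_ne_zero

lemma differentiableAt_clock (hx : ∀ i, α i ≠ 0 → x₀ i.castSucc ≠ 0) (hv : v (Fin.last n) ≠ 0)
    (k : Fin (n + 1)) : DifferentiableAt ℝ (fun w => clock α x₀ w 1 k) v := by
  induction k using Fin.induction with
  | zero => simp
  | succ i ih =>
    simp only [clock_succ]
    exact differentiableAt_oscClock (hx i) (nest_pos hx hv i.succ) (by fun_prop)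
      (differentiable_nest _ _) ih

lemma differentiableAt_flowPos (hx : ∀ i, α i ≠ 0 → x₀ i.castSucc ≠ 0)
    (hv : v (Fin.last n) ≠ 0) : DifferentiableAt ℝ (fun w => flowPos α x₀ w 1) v := by
  refine differentiableAt_pi.2 fun j => ?_
  induction j using Fin.lastCases with
  | last =>
    simp only [flowPos_last]
    have := differentiableAt_clock (α := α) hx hv (Fin.last n)
    fun_prop
  | cast i =>
    simp only [flowPos_castSucc]
    exact differentiableAt_oscPos (hx i) (nest_pos hx hv i.succ) (by fun_prop)
      (differentiable_nest _ _) (differentiableAt_clock hx hv _)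

/-- The explicit flow describes the exponential map where the last covector component is nonzero.
This is an open condition, so the derivatives agree. -/
lemma fderiv_expMap (hx : ∀ i, α i ≠ 0 → x₀ i.castSucc ≠ 0) (hv : v (Fin.last n) ≠ 0) :
    fderiv ℝ (expMap α x₀) v = fderiv ℝ (fun w => flowPos α x₀ w 1) v := by
  refine Filter.EventuallyEq.fderiv_eq ?_
  have : ∀ᶠ w : Fin (n + 1) → ℝ in 𝓝 v, w (Fin.last n) ≠ 0 :=
    (continuous_apply (Fin.last n)).continuousAt.eventually_ne hv
  filter_upwards [this] with w hw
  rw [expMap, geodesic_eq_flowPos hx hw]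

/-- In equal finite dimensions, failure of surjectivity means a nonzero kernel vector. Testing it
along the line `v + r • w` reduces the question to the one-parameter variations of the oscillators.
-/
lemma isCriticalCovector_iff (hx : ∀ i, α i ≠ 0 → x₀ i.castSucc ≠ 0)
    (hv : v (Fin.last n) ≠ 0) :
    IsCriticalCovector α x₀ v ↔
      ∃ w, w ≠ 0 ∧ ∀ j, HasDerivAt (fun r : ℝ => flowPos α x₀ (v + r • w) 1 j) 0 0 := by
  have hline : ∀ w : Fin (n + 1) → ℝ, HasDerivAt (fun r : ℝ => v + r • w) w 0 := fun w => by
    simpa using ((hasDerivAt_id' (0 : ℝ)).smul_const w).const_add v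
  have hd : ∀ w, HasDerivAt (fun r : ℝ => flowPos α x₀ (v + r • w) 1)
      (fderiv ℝ (fun w => flowPos α x₀ w 1) v w) 0 := fun w => by
    refine HasFDerivAt.comp_hasDerivAt (f := fun r : ℝ => v + r • w)
      (l := fun w => flowPos α x₀ w 1) 0 ?_ (hline w)
    simpa using (differentiableAt_flowPos hx hv).hasFDerivAt
  have hinj := LinearMap.injective_iff_surjective
    (f := (fderiv ℝ (fun w => flowPos α x₀ w 1) v).toLinearMap)
  rw [IsCriticalCovector, fderiv_expMap hx hv]
  have hker : (∃ w, w ≠ 0 ∧ ∀ j, HasDerivAt (fun r : ℝ => flowPos α x₀ (v + r • w) 1 j) 0 0) ↔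
      ∃ w, w ≠ 0 ∧ fderiv ℝ (fun w => flowPos α x₀ w 1) v w = 0 := by
    refine exists_congr fun w => and_congr_right fun _ => ⟨fun h => ?_, fun h j => ?_⟩
    · exact (hd w).unique (hasDerivAt_pi.2 h)
    · have := hasDerivAt_pi.1 (hd w) j
      rwa [h] at this
  rw [hker, ← not_iff_not, not_not]
  refine hinj.symm.trans ?_
  rw [injective_iff_map_eq_zero]
  push Not
  exact forall_congr' fun w => ⟨fun h h1 h2 => h1 (h h2), fun h h2 => by
    by_contra h1
    exact h h1 h2⟩

lemma hasDerivAt_line_apply (w : Fin (n + 1) → ℝ) (j : Fin (n + 1)) :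
    HasDerivAt (fun r : ℝ => (v + r • w) j) (w j) 0 := by
  simpa using ((hasDerivAt_id' (0 : ℝ)).mul_const (w j)).const_add (v j)

/-- The exponential map is regular at `v` if no level is at a focal point. -/
lemma not_isCriticalCovector (hx : ∀ i, α i ≠ 0 → x₀ i.castSucc ≠ 0)
    (hv : v (Fin.last n) ≠ 0)
    (hf : ∀ i : Fin n, α i ≠ 0 →
      focal (α i) (oscPhase (α i) (x₀ i.castSucc) (v i.castSucc) (nest α x₀ v i.succ))
        (oscAngle (α i) (x₀ i.castSucc) (v i.castSucc) (nest α x₀ v i.succ)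
          (clock α x₀ v 1 i.castSucc)) ≠ 0) :
    ¬ IsCriticalCovector α x₀ v := by
  rw [isCriticalCovector_iff hx hv]
  rintro ⟨w, hw, hflow⟩
  have hv0 : v + (0 : ℝ) • w = v := by simp
  have hp := hasDerivAt_line_apply (v := v) w
  have hdiff : ∀ r : ℝ, DifferentiableAt ℝ (fun r : ℝ => v + r • w) r := fun r => by fun_prop
  obtain ⟨N', hN⟩ : ∃ N' : Fin (n + 1) → ℝ, ∀ k,
      HasDerivAt (fun r : ℝ => nest α x₀ (v + r • w) k) (N' k) 0 :=
    ⟨_, fun k => (DifferentiableAt.comp (g := fun w => nest α x₀ w k) 0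
      (differentiable_nest k _) (hdiff 0)).hasDerivAt⟩
  obtain ⟨S', hS⟩ : ∃ S' : Fin (n + 1) → ℝ, ∀ k,
      HasDerivAt (fun r : ℝ => clock α x₀ (v + r • w) 1 k) (S' k) 0 :=
    ⟨_, fun k => (DifferentiableAt.comp (g := fun w => clock α x₀ w 1 k) 0
      (by rw [hv0]; exact differentiableAt_clock hx hv k) (hdiff 0)).hasDerivAt⟩
  have hpos : ∀ k, 0 < nest α x₀ (v + (0 : ℝ) • w) k := fun k => by
    rw [hv0]
    exact nest_pos hx hv k
  have hSpos : ∀ k, 0 < clock α x₀ (v + (0 : ℝ) • w) 1 k := fun k => by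
    rw [hv0]
    exact clock_pos hx hv one_pos k
  have hlast : w (Fin.last n) * clock α x₀ (v + (0 : ℝ) • w) 1 (Fin.last n) +
      (v + (0 : ℝ) • w) (Fin.last n) * S' (Fin.last n) = 0 := by
    have h1 := hflow (Fin.last n)
    simp only [flowPos_last] at h1
    exact (((hp _).mul (hS _)).const_add _).unique h1
  -- The balance starts at the last level, from the fixed last coordinate, and `osc_balance` carries
  -- it back to the first.
  have hbal : ∀ k, 2 * nest α x₀ (v + (0 : ℝ) • w) k * S' k +
      clock α x₀ (v + (0 : ℝ) • w) 1 k * N' k = 0 := by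
    intro k
    induction k using Fin.reverseInduction with
    | last =>
      have h1 := hN (Fin.last n)
      simp only [nest_last] at h1
      have h2 := h1.unique ((hp (Fin.last n)).pow 2)
      rw [h2, nest_last]
      push_cast
      linear_combination (2 * (v + (0 : ℝ) • w) (Fin.last n)) * hlast
    | cast i ih =>
      have h1 := hflow i.castSucc
      have h2 := hN i.castSucc
      have h3 := hS i.succ
      simp only [flowPos_castSucc] at h1
      simp only [nest_castSucc] at h2
      simp only [clock_succ] at h3
      have h4 := osc_balance (p := fun r : ℝ => (v + r • w) i.castSucc)
          (c := fun r : ℝ => nest α x₀ (v + r • w) i.succ)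
          (s := fun r : ℝ => clock α x₀ (v + r • w) 1 i.castSucc) (hx i) (hpos i.succ) (hp _) (hN i.succ) (hS i.castSucc) h2 h3 h1
      rw [nest_castSucc, ← h4]
      exact ih
  have hrigid : ∀ i : Fin n, S' i.castSucc = 0 → N' i.castSucc = 0 →
      w i.castSucc = 0 ∧ N' i.succ = 0 ∧ S' i.succ = 0 := by
    intro i hs hE
    have h1 := hflow i.castSucc
    have h2 := hN i.castSucc
    have h3 := hS i.succ
    simp only [flowPos_castSucc] at h1
    simp only [nest_castSucc] at h2
    simp only [clock_succ] at h3
    exact osc_rigid (p := fun r : ℝ => (v + r • w) i.castSucc)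
          (c := fun r : ℝ => nest α x₀ (v + r • w) i.succ)
          (s := fun r : ℝ => clock α x₀ (v + r • w) 1 i.castSucc) (hx i) (hpos i.succ) (hp _) (hN i.succ) (hS i.castSucc) h2 h3 h1 hs hE
      (hSpos _).ne' (by simpa only [hv0] using hf i)
  -- The first clock is the constant time 1, so its variation is zero and the balance there kills
  -- the variation of the total energy. Rigidity then carries both zeros up the chain.
  have hzero : ∀ k, S' k = 0 ∧ N' k = 0 := by
    intro k
    induction k using Fin.induction with
    | zero =>
      have h1 := hS 0
      simp only [clock_zero] at h1
      have h2 := h1.unique (hasDerivAt_const _ _)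
      have h3 := hbal 0
      rw [h2] at h3
      simpa [h2] using h3
    | succ i ih => exact (hrigid i ih.1 ih.2).2.symm
  refine hw (funext fun j => ?_)
  induction j using Fin.lastCases with
  | last =>
    rw [(hzero _).1, mul_zero, add_zero] at hlast
    exact (mul_eq_zero.1 hlast).resolve_right (hSpos _).ne'
  | cast i => exact (hrigid i (hzero _).1 (hzero _).2).1

/-- The exponential map is critical at `v` if some level starts at rest and completes exactly
half a period. -/
lemma isCriticalCovector_of_focus (hx : ∀ i, α i ≠ 0 → x₀ i.castSucc ≠ 0)
    (hv : v (Fin.last n) ≠ 0) {i : Fin n} (hα : α i ≠ 0) (hvi : v i.castSucc = 0)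
    (hπ : oscFreq (α i) (x₀ i.castSucc) (v i.castSucc) (nest α x₀ v i.succ) *
      clock α x₀ v 1 i.castSucc = genPi (α i)) : IsCriticalCovector α x₀ v := by
  rw [isCriticalCovector_iff hx hv]
  -- Only the momentum of the level at rest is varied.
  set w : Fin (n + 1) → ℝ := Pi.single i.castSucc 1
  have hw : w ≠ 0 := by simp [w]
  refine ⟨w, hw, ?_⟩
  have hv0 : v + (0 : ℝ) • w = v := by simp
  have hp := hasDerivAt_line_apply (v := v) w
  have hpos : ∀ k, 0 < nest α x₀ (v + (0 : ℝ) • w) k := fun k => by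
    rw [hv0]
    exact nest_pos hx hv k
  have hwl : w (Fin.last n) = 0 := by
    simp [w, (Fin.castSucc_lt_last i).ne']
  have hwk : ∀ k : Fin n, k ≠ i → w k.castSucc = 0 := fun k hk => by
    simp [w, hk]
  -- The variation enters the nested energies quadratically: its first-order contribution is `2 v_i
  -- w_i`, and `v_i = 0`.
  have hN : ∀ k, HasDerivAt (fun r : ℝ => nest α x₀ (v + r • w) k) 0 0 := by
    intro k
    induction k using Fin.reverseInduction with
    | last =>
      simp only [nest_last]
      exact ((hp _).pow 2).congr_deriv (by rw [hwl, mul_zero])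
    | cast k ih =>
      simp only [nest_castSucc]
      refine (hasDerivAt_oscEnergy_param (hp _) ih).congr_deriv ?_
      by_cases hk : k = i
      · rw [hk, hv0, hvi]
        simp
      · rw [hwk k hk]
        simp
  have hstep : ∀ k : Fin n,
      HasDerivAt (fun r : ℝ => clock α x₀ (v + r • w) 1 k.castSucc) 0 0 →
      HasDerivAt (fun r : ℝ => flowPos α x₀ (v + r • w) 1 k.castSucc) 0 0 ∧
      HasDerivAt (fun r : ℝ => clock α x₀ (v + r • w) 1 k.succ) 0 0 := by
    intro k hk
    simp only [flowPos_castSucc, clock_succ]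
    by_cases hki : k = i
    · subst hki
      exact osc_focus (p := fun r : ℝ => (v + r • w) k.castSucc)
          (c := fun r : ℝ => nest α x₀ (v + r • w) k.succ)
          (s := fun r : ℝ => clock α x₀ (v + r • w) 1 k.castSucc) hα (hx k) (hpos k.succ) (hp _) (hN _) hk (by rw [hv0, hvi])
        (by rw [hv0]; exact hπ)
    · have := hp k.castSucc
      rw [hwk k hki] at this
      exact osc_const (p := fun r : ℝ => (v + r • w) k.castSucc)
          (c := fun r : ℝ => nest α x₀ (v + r • w) k.succ)
          (s := fun r : ℝ => clock α x₀ (v + r • w) 1 k.castSucc) (hx k) (hpos k.succ) this (hN _) hk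
  have hS : ∀ k, HasDerivAt (fun r : ℝ => clock α x₀ (v + r • w) 1 k) 0 0 := by
    intro k
    induction k using Fin.induction with
    | zero =>
      simp only [clock_zero]
      exact hasDerivAt_const _ _
    | succ k ih => exact (hstep k ih).2
  intro j
  induction j using Fin.lastCases with
  | last =>
    simp only [flowPos_last]
    exact (((hp _).mul (hS _)).const_add _).congr_deriv (by rw [hwl]; ring)
  | cast k => exact (hstep k (hS _)).1

end Exp

/-! ### Conjugate times -/

section ConjTime

variable {n : ℕ} {α : Fin n → ℕ} {x₀ v : Fin (n + 1) → ℝ}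

/-- If `x_i` vanished with `α_i ≠ 0`, then `ξ_{i+1}` would vanish and all the fields would lie in
the kernel of one coordinate functional. -/
lemma IsRiemannianPoint.ne_zero (h : IsRiemannianPoint α x₀) (i : Fin n) (hα : α i ≠ 0) :
    x₀ i.castSucc ≠ 0 := by
  intro hx
  have hxi : xi α i.succ x₀ = 0 := by rw [xi_succ, hx, zero_pow hα, mul_zero]
  have hle : Submodule.span ℝ (Set.range fun j => vectorField α j x₀) ≤
      LinearMap.ker (LinearMap.proj (R := ℝ) (φ := fun _ : Fin (n + 1) => ℝ) i.succ) := by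
    refine Submodule.span_le.2 ?_
    rintro _ ⟨j, rfl⟩
    simp only [SetLike.mem_coe, LinearMap.mem_ker, LinearMap.proj_apply, vectorField]
    by_cases hj : j = i.succ
    · subst hj
      rw [Pi.single_eq_same, hxi]
    · rw [Pi.single_eq_of_ne (Ne.symm hj)]
  rw [IsRiemannianPoint] at h
  rw [h] at hle
  have := hle (Submodule.mem_top (x := Pi.single i.succ (1 : ℝ)))
  simp at this

/-- The phase accumulated by the `i`-th oscillator up to time `t`. -/
def phaseShift (α : Fin n → ℕ) (x₀ v : Fin (n + 1) → ℝ) (i : Fin n) (t : ℝ) : ℝ :=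
  oscFreq (α i) (x₀ i.castSucc) (v i.castSucc) (nest α x₀ v i.succ) *
    clock α x₀ v t i.castSucc

/-- The initial phase of the `i`-th oscillator. -/
def initPhase (α : Fin n → ℕ) (x₀ v : Fin (n + 1) → ℝ) (i : Fin n) : ℝ :=
  oscPhase (α i) (x₀ i.castSucc) (v i.castSucc) (nest α x₀ v i.succ)

lemma phaseShift_smul {t : ℝ} (ht : 0 < t) (i : Fin n) :
    phaseShift α x₀ (t • v) i 1 = phaseShift α x₀ v i t := by
  rw [phaseShift, phaseShift, ← clock_smul ht, nest_smul, Pi.smul_apply, smul_eq_mul, oscFreq,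
    oscFreq, oscAmp_scale ht, sqrt_oscEnergy_scale ht]
  ring

lemma initPhase_smul {t : ℝ} (ht : 0 < t) (i : Fin n) :
    initPhase α x₀ (t • v) i = initPhase α x₀ v i := by
  rw [initPhase, nest_smul, Pi.smul_apply, smul_eq_mul, oscPhase_scale ht, initPhase]

lemma not_isCriticalCovector_smul (hx : ∀ i, α i ≠ 0 → x₀ i.castSucc ≠ 0)
    (hv : v (Fin.last n) ≠ 0) {t : ℝ} (ht : 0 < t)
    (hf : ∀ i, α i ≠ 0 → focal (α i) (initPhase α x₀ v i)
      (initPhase α x₀ v i + phaseShift α x₀ v i t) ≠ 0) :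
    ¬ IsCriticalCovector α x₀ (t • v) := by
  refine not_isCriticalCovector hx (by simp [ht.ne', hv]) fun i hi => ?_
  have := hf i hi
  rwa [← phaseShift_smul ht, ← initPhase_smul ht] at this

lemma isCriticalCovector_smul (hx : ∀ i, α i ≠ 0 → x₀ i.castSucc ≠ 0)
    (hv : v (Fin.last n) ≠ 0) {t : ℝ} (ht : 0 < t) {i : Fin n} (hα : α i ≠ 0)
    (hvi : v i.castSucc = 0) (hπ : phaseShift α x₀ v i t = genPi (α i)) :
    IsCriticalCovector α x₀ (t • v) := by
  refine isCriticalCovector_of_focus hx (by simp [ht.ne', hv]) hα (by simp [hvi]) ?_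
  rw [← phaseShift_smul ht] at hπ
  exact hπ

lemma initPhase_mem (hx : ∀ i, α i ≠ 0 → x₀ i.castSucc ≠ 0) (hv : v (Fin.last n) ≠ 0)
    {i : Fin n} (hα : α i ≠ 0) : initPhase α x₀ v i ∈ Ioo 0 (genPi (α i)) :=
  oscPhase_mem hα (hx i) (nest_pos hx hv i.succ)

lemma genCos_initPhase_ne_zero (hx : ∀ i, α i ≠ 0 → x₀ i.castSucc ≠ 0)
    (hv : v (Fin.last n) ≠ 0) {i : Fin n} (hα : α i ≠ 0) (hvi : v i.castSucc ≠ 0) :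
    genCos (α i) (initPhase α x₀ v i) ≠ 0 := by
  have hc := nest_pos hx hv i.succ
  rw [initPhase, genCos_oscPhase hα (hx i) hc]
  exact div_ne_zero (mul_ne_zero (div_ne_zero (hx i hα) (abs_pos.2 (hx i hα)).ne') hvi)
    (Real.sqrt_pos.2 (oscEnergy_pos (hx i) hc)).ne'

lemma phaseShift_strictMono (hx : ∀ i, α i ≠ 0 → x₀ i.castSucc ≠ 0) (hv : v (Fin.last n) ≠ 0)
    (i : Fin n) : StrictMono (phaseShift α x₀ v i) := fun _ _ h =>
  mul_lt_mul_of_pos_left (clock_strictMono hx hv i.castSucc h)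
    (oscFreq_pos (hx i) (nest_pos hx hv i.succ))

lemma phaseShift_zero (hx : ∀ i, α i ≠ 0 → x₀ i.castSucc ≠ 0) (hv : v (Fin.last n) ≠ 0)
    (i : Fin n) : phaseShift α x₀ v i 0 = 0 := by
  rw [phaseShift, clock_time_zero hx hv, mul_zero]

lemma phaseShift_continuous (hx : ∀ i, α i ≠ 0 → x₀ i.castSucc ≠ 0)
    (hv : v (Fin.last n) ≠ 0) (i : Fin n) : Continuous (phaseShift α x₀ v i) :=
  continuous_const.mul (clock_continuous hx hv i.castSucc)

lemma exists_phaseShift_eq (hx : ∀ i, α i ≠ 0 → x₀ i.castSucc ≠ 0) (hv : v (Fin.last n) ≠ 0)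
    (i : Fin n) {y : ℝ} (hy : 0 < y) : ∃ t, 0 < t ∧ phaseShift α x₀ v i t = y := by
  have htop : Tendsto (phaseShift α x₀ v i) atTop atTop :=
    (clock_tendsto hx hv i.castSucc).const_mul_atTop
      (oscFreq_pos (hx i) (nest_pos hx hv i.succ))
  obtain ⟨T, hT⟩ := (htop.eventually_ge_atTop y).exists
  have h0 := phaseShift_zero (α := α) hx hv i
  have hmono := phaseShift_strictMono (α := α) hx hv i
  have hT0 : 0 ≤ T := by
    rw [← hmono.le_iff_le, h0]
    linarith
  obtain ⟨t, -, h⟩ := intermediate_value_Icc hT0 (phaseShift_continuous hx hv i).continuousOn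
    ⟨h0.symm ▸ hy.le, hT⟩
  refine ⟨t, ?_, h⟩
  rw [← hmono.lt_iff_lt, h0, h]
  exact hy

lemma focal_ne_zero_of_lt (hx : ∀ i, α i ≠ 0 → x₀ i.castSucc ≠ 0) (hv : v (Fin.last n) ≠ 0)
    {i : Fin n} (hα : α i ≠ 0) {t : ℝ} (ht : 0 < t) (h : phaseShift α x₀ v i t < genPi (α i)) :
    focal (α i) (initPhase α x₀ v i) (initPhase α x₀ v i + phaseShift α x₀ v i t) ≠ 0 := by
  have h0 := phaseShift_strictMono hx hv i ht
  rw [phaseShift_zero hx hv] at h0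
  exact (focal_pos hα (initPhase_mem hx hv hα) ⟨by linarith, by linarith⟩).ne'

/-! ### The initial covector in generalized spherical coordinates -/

variable {φ : Fin n → ℝ}

lemma tildeExp_ne_zero (i : Fin n) : tildeExp α i ≠ 0 := by
  rw [tildeExp]
  split_ifs with h
  · exact one_ne_zero
  · exact h

lemma tildeExp_of_ne {i : Fin n} (hα : α i ≠ 0) : tildeExp α i = α i := if_neg hα

lemma delta_of_ne {i : Fin n} (hα : α i ≠ 0) :
    delta α x₀ φ i = |genSin (α i) (φ i) / x₀ i.castSucc| ^ (α i - 1) *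
      (genSin (α i) (φ i) / x₀ i.castSucc) := by
  rw [delta, rho, tildeExp_of_ne hα, tildePt, if_neg hα]

lemma delta_sq_of_ne {i : Fin n} (hα : α i ≠ 0) :
    delta α x₀ φ i ^ 2 = (genSin (α i) (φ i) / x₀ i.castSucc) ^ (2 * α i) := by
  rw [delta_of_ne hα, mul_pow, ← pow_mul, mul_comm (α i - 1) 2, (even_two_mul _).pow_abs,
    ← pow_add]
  congr 1
  omega

/-- The Pythagorean identity at angle `φ_i`. For a zero exponent, the replacements in `tildeExp` and
`tildePt` make it the ordinary one, since the power of `x_i` is then 1. -/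
lemma genCos_sq_add_delta_sq (hx : ∀ i, α i ≠ 0 → x₀ i.castSucc ≠ 0) (i : Fin n) :
    genCos (tildeExp α i) (φ i) ^ 2 + delta α x₀ φ i ^ 2 * x₀ i.castSucc ^ (2 * α i) = 1 := by
  rw [← genCos_sq_add (tildeExp_ne_zero (α := α) i) (φ i), add_right_inj]
  by_cases hα : α i = 0
  · simp [delta, rho, tildeExp, tildePt, hα]
  · rw [delta_sq_of_ne hα, ← mul_pow, div_mul_cancel₀ _ (hx i hα), tildeExp_of_ne hα]

lemma delta_ne_zero (hx : ∀ i, α i ≠ 0 → x₀ i.castSucc ≠ 0) (hφ : φ ∈ rectangle0 α) (i : Fin n) :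
    delta α x₀ φ i ≠ 0 := by
  have h : genSin (tildeExp α i) (φ i) / tildePt α x₀ i ≠ 0 := by
    refine div_ne_zero (hφ.2 i) ?_
    rw [tildePt]
    split_ifs with h
    · exact one_ne_zero
    · exact hx i h
  exact mul_ne_zero (pow_ne_zero _ (abs_ne_zero.2 h)) h

/-- The partial products of the `δ_i`. -/
def prodDelta (α : Fin n → ℕ) (x₀ : Fin (n + 1) → ℝ) (φ : Fin n → ℝ) (k : Fin (n + 1)) : ℝ :=
  ∏ i : Fin n with i.castSucc < k, delta α x₀ φ i

lemma prodDelta_succ (i : Fin n) :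
    prodDelta α x₀ φ i.succ = prodDelta α x₀ φ i.castSucc * delta α x₀ φ i := by
  have h : (Finset.univ.filter fun k : Fin n => k.castSucc < i.succ) =
      insert i (Finset.univ.filter fun k : Fin n => k.castSucc < i.castSucc) := by
    ext k
    simp only [Finset.mem_filter, Finset.mem_univ, true_and, Finset.mem_insert, Fin.lt_def,
      Fin.val_castSucc, Fin.val_succ, Fin.ext_iff]
    omega
  rw [prodDelta, h, Finset.prod_insert (by simp), mul_comm, prodDelta]

lemma covector_castSucc (i : Fin n) : covector α x₀ φ i.castSucc =
    genCos (tildeExp α i) (φ i) * prodDelta α x₀ φ i.castSucc := by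
  simp [covector, prodDelta]

lemma covector_last : covector α x₀ φ (Fin.last n) = prodDelta α x₀ φ (Fin.last n) := by
  simp [covector, prodDelta, Fin.castSucc_lt_last]

lemma prodDelta_ne_zero (hx : ∀ i, α i ≠ 0 → x₀ i.castSucc ≠ 0) (hφ : φ ∈ rectangle0 α)
    (k : Fin (n + 1)) : prodDelta α x₀ φ k ≠ 0 :=
  Finset.prod_ne_zero_iff.2 fun i _ => delta_ne_zero hx hφ i

/-- The spherical coordinates are built so that the nested energies telescope to squares of partial
products. At level 1 the product is empty, so the covector has `2H = 1`. -/
lemma nest_covector (hx : ∀ i, α i ≠ 0 → x₀ i.castSucc ≠ 0) (k : Fin (n + 1)) :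
    nest α x₀ (covector α x₀ φ) k = prodDelta α x₀ φ k ^ 2 := by
  induction k using Fin.reverseInduction with
  | last => rw [nest_last, covector_last]
  | cast i ih =>
    rw [nest_castSucc, ih, oscEnergy, covector_castSucc, prodDelta_succ]
    linear_combination prodDelta α x₀ φ i.castSucc ^ 2 * genCos_sq_add_delta_sq (φ := φ) hx i

/-- The energy of level `i` is the square of the partial product of the `δ`'s, and its amplitude is
`|x_i / sin(φ_i)|`. The quotient of the square root by the amplitude is `|ω_i|`. -/
lemma oscFreq_covector (hx : ∀ i, α i ≠ 0 → x₀ i.castSucc ≠ 0) (hφ : φ ∈ rectangle0 α)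
    {i : Fin n} (hα : α i ≠ 0) :
    oscFreq (α i) (x₀ i.castSucc) (covector α x₀ φ i.castSucc)
      (nest α x₀ (covector α x₀ φ) i.succ) = |omega α x₀ φ i| := by
  have hE : oscEnergy (α i) (x₀ i.castSucc) (covector α x₀ φ i.castSucc)
      (nest α x₀ (covector α x₀ φ) i.succ) = prodDelta α x₀ φ i.castSucc ^ 2 := by
    rw [← nest_castSucc, nest_covector hx]
  have hP := prodDelta_ne_zero hx hφ
  have hc : 0 < nest α x₀ (covector α x₀ φ) i.succ :=
    nest_pos hx (by rw [covector_last]; exact hP _) i.succ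
  have hA := oscAmp_pos (p := covector α x₀ φ i.castSucc) (hx i) hc
  have hpow := oscAmp_pow (p := covector α x₀ φ i.castSucc) hα (hx i) hc
  rw [hE] at hpow
  nth_rewrite 1 [nest_covector hx] at hpow
  rw [oscFreq, hE, Real.sqrt_sq_eq_abs]
  set A := oscAmp (α i) (x₀ i.castSucc) (covector α x₀ φ i.castSucc)
    (nest α x₀ (covector α x₀ φ) i.succ)
  rw [prodDelta_succ, mul_pow, delta_sq_of_ne hα, mul_assoc, ← mul_pow] at hpow
  have h1 : (genSin (α i) (φ i) / x₀ i.castSucc * A) ^ (2 * α i) = 1 := by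
    have h2 := pow_ne_zero 2 (hP i.castSucc)
    exact mul_left_cancel₀ h2 (hpow.trans (mul_one _).symm)
  have h3 : |genSin (α i) (φ i) / x₀ i.castSucc| * A = 1 := by
    rw [← (even_two_mul _).pow_abs, abs_mul, abs_of_pos hA] at h1
    exact (pow_eq_one_iff_of_nonneg (by positivity) (by omega)).1 h1
  have h4 : omega α x₀ φ i =
      genSin (α i) (φ i) / x₀ i.castSucc * prodDelta α x₀ φ i.castSucc := by
    simp [omega, prodDelta]
  rw [h4, abs_mul, div_eq_iff hA.ne']
  linear_combination -|prodDelta α x₀ φ i.castSucc| * h3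

/-! ### The times `τ_j` as half-period times, and the comparison with the conjugate time -/

lemma integral_xi_sq (hx : ∀ i, α i ≠ 0 → x₀ i.castSucc ≠ 0) (hv : v (Fin.last n) ≠ 0)
    (k : Fin (n + 1)) (t : ℝ) :
    ∫ s in (0 : ℝ)..t, xi α k (geodesic α x₀ v s) ^ 2 = clock α x₀ v t k := by
  rw [geodesic_eq_flowPos hx hv, intervalIntegral.integral_eq_sub_of_hasDerivAt
    (fun s _ => hasDerivAt_clock hx hv s k), clock_time_zero hx hv, sub_zero]
  refine Continuous.intervalIntegrable ?_ _ _
  refine ((contDiff_xi k).continuous.comp ?_).pow 2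
  refine continuous_iff_continuousAt.2 fun s => continuousAt_pi.2 fun j => ?_
  exact ((isExtremal_iff.1 (isExtremal_flow hx hv) s j).1).continuousAt

lemma tauSet_eq (hx : ∀ i, α i ≠ 0 → x₀ i.castSucc ≠ 0) (hφ : φ ∈ rectangle0 α)
    {i : Fin n} (hα : α i ≠ 0) :
    tauSet α x₀ φ i = {t | 0 < t ∧ phaseShift α x₀ (covector α x₀ φ) i t = genPi (α i)} := by
  have hv : covector α x₀ φ (Fin.last n) ≠ 0 := by
    rw [covector_last]
    exact prodDelta_ne_zero hx hφ _
  ext t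
  rw [tauSet, mem_ofPred_eq, mem_ofPred_eq, integral_xi_sq hx hv, phaseShift,
    oscFreq_covector hx hφ hα]

/-- The accumulated phase increases strictly and continuously from 0 to infinity, so the set of
admissible times is a singleton. -/
lemma isLeast_tauSet (hx : ∀ i, α i ≠ 0 → x₀ i.castSucc ≠ 0) (hφ : φ ∈ rectangle0 α)
    {i : Fin n} (hα : α i ≠ 0) : IsLeast (tauSet α x₀ φ i) (tauComp α x₀ φ i) := by
  have hv : covector α x₀ φ (Fin.last n) ≠ 0 := by
    rw [covector_last]
    exact prodDelta_ne_zero hx hφ _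
  obtain ⟨t, ht⟩ := exists_phaseShift_eq (α := α) hx hv i (genPi_pos hα)
  have h : tauSet α x₀ φ i = {t} := by
    rw [tauSet_eq hx hφ hα]
    ext s
    refine ⟨fun hs => ?_, ?_⟩
    · exact (phaseShift_strictMono hx hv i).injective (hs.2.trans ht.2.symm)
    · rintro rfl
      exact ht
  rw [tauComp, h, csInf_singleton]
  exact isLeast_singleton

lemma covector_eq_zero_iff (hx : ∀ i, α i ≠ 0 → x₀ i.castSucc ≠ 0) (hφ : φ ∈ rectangle0 α)
    {i : Fin n} (hα : α i ≠ 0) : covector α x₀ φ i.castSucc = 0 ↔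
      φ i = genPi (α i) / 2 ∨ φ i = 3 * genPi (α i) / 2 := by
  rw [covector_castSucc, mul_eq_zero, or_iff_left (prodDelta_ne_zero hx hφ _),
    tildeExp_of_ne hα]
  refine genCos_eq_zero_iff hα ?_
  have hpi := genPi_pos hα
  have h := hφ.1 i
  rw [tildeExp_of_ne hα] at h
  -- Only the last angle ranges over a full period; the others lie in `[0, π]`, which is also
  -- contained in `[0, 2π)`.
  rcases lt_or_eq_of_le (show i.val + 1 ≤ n from i.isLt) with hi | hi
  · exact ⟨(h.1 hi).1, by linarith [(h.1 hi).2]⟩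
  · exact h.2 hi

lemma mem_J {i : Fin n} : i ∈ J α ↔ α i ≠ 0 := by simp [J]

/-- Strict inequality passes through the infimum because `J` is finite. For empty `J` it reads `t <
⊤`. -/
lemma coe_lt_tau_iff {t : ℝ} :
    (t : EReal) < tau α x₀ φ ↔ ∀ j ∈ J α, t < tauComp α x₀ φ j := by
  rw [tau, ← Finset.inf_eq_iInf, Finset.lt_inf_iff (EReal.coe_lt_top t)]
  simp

/-- Comparison of `τ` with the first conjugate time, and the equality case. -/
theorem isLeast_tauComp_and_tau_le_conjTime (n : ℕ) (α : Fin n → ℕ) (x₀ : Fin (n + 1) → ℝ)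
    (hx₀ : IsRiemannianPoint α x₀)
    (φ : Fin n → ℝ) (hφ : φ ∈ rectangle0 α) :
    (∀ j ∈ J α, IsLeast (tauSet α x₀ φ j) (tauComp α x₀ φ j)) ∧
    0 < tau α x₀ φ ∧
    tau α x₀ φ ≤ conjTime α x₀ (covector α x₀ φ) ∧
    ((J α).Nonempty →
      (tau α x₀ φ = conjTime α x₀ (covector α x₀ φ) ↔
        ∃ j ∈ J α, tau α x₀ φ = (tauComp α x₀ φ j : EReal) ∧
          (φ j = genPi (α j) / 2 ∨ φ j = 3 * genPi (α j) / 2))) := by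
  have hx := hx₀.ne_zero
  have hv : covector α x₀ φ (Fin.last n) ≠ 0 := by
    rw [covector_last]
    exact prodDelta_ne_zero hx hφ _
  have hleast : ∀ j ∈ J α, IsLeast (tauSet α x₀ φ j) (tauComp α x₀ φ j) :=
    fun j hj => isLeast_tauSet hx hφ (mem_J.1 hj)
  have hτ : ∀ j ∈ J α, 0 < tauComp α x₀ φ j ∧
      phaseShift α x₀ (covector α x₀ φ) j (tauComp α x₀ φ j) = genPi (α j) := by
    intro j hj
    have := (hleast j hj).1
    rwa [tauSet_eq hx hφ (mem_J.1 hj)] at this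
  have hfocal : ∀ j ∈ J α, ∀ t, 0 < t → t < tauComp α x₀ φ j →
      focal (α j) (initPhase α x₀ (covector α x₀ φ) j) (initPhase α x₀ (covector α x₀ φ) j +
        phaseShift α x₀ (covector α x₀ φ) j t) ≠ 0 := fun j hj t ht htj =>
    focal_ne_zero_of_lt hx hv (mem_J.1 hj) ht
      ((phaseShift_strictMono hx hv j htj).trans_eq (hτ j hj).2)
  have hle : tau α x₀ φ ≤ conjTime α x₀ (covector α x₀ φ) := by
    refine le_iInf₂ fun t ht => not_lt.1 fun hlt => ?_
    rw [coe_lt_tau_iff] at hlt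
    exact not_isCriticalCovector_smul hx hv ht.1
      (fun i hi => hfocal i (mem_J.2 hi) t ht.1 (hlt i (mem_J.2 hi))) ht.2
  refine ⟨hleast, ?_, hle, fun hJ => ⟨fun heq => ?_, ?_⟩⟩
  · rw [← EReal.coe_zero, coe_lt_tau_iff]
    exact fun j hj => (hτ j hj).1
  · by_contra! hcon
    obtain ⟨j₀, hj₀, hmin⟩ := Finset.exists_min_image (J α) (tauComp α x₀ φ) hJ
    have htau : tau α x₀ φ = (tauComp α x₀ φ j₀ : EReal) :=
      le_antisymm (iInf₂_le j₀ hj₀) (le_iInf₂ fun j hj => EReal.coe_le_coe_iff.2 (hmin j hj))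
    -- Nonvanishing of finitely many continuous determinants is an open condition, so it only has to
    -- be checked at `τ`. A level attaining `τ` has the value `π cos²ψ`, nonzero because it does not
    -- start at rest; any other level has not yet reached half a period.
    have hnear : ∀ᶠ t in 𝓝 (tauComp α x₀ φ j₀), ∀ j, α j ≠ 0 →
        focal (α j) (initPhase α x₀ (covector α x₀ φ) j) (initPhase α x₀ (covector α x₀ φ) j +
          phaseShift α x₀ (covector α x₀ φ) j t) ≠ 0 := by
      refine eventually_all.2 fun j => ?_
      by_cases hα : α j = 0
      · exact Eventually.of_forall fun _ h => absurd hα h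
      have hcont : Continuous fun t => focal (α j) (initPhase α x₀ (covector α x₀ φ) j)
          (initPhase α x₀ (covector α x₀ φ) j + phaseShift α x₀ (covector α x₀ φ) j t) :=
        (continuous_iff_continuousAt.2 fun θ =>
          (hasDerivAt_focal_right hα _ θ).continuousAt).comp
          (continuous_const.add (phaseShift_continuous hx hv j))
      refine (hcont.continuousAt.eventually_ne ?_).mono fun _ h _ => h
      rcases eq_or_lt_of_le (hmin j (mem_J.2 hα)) with h | h
      · rw [h, (hτ j (mem_J.2 hα)).2, focal_add_pi hα]
        refine mul_ne_zero (genPi_pos hα).ne' (pow_ne_zero 2 ?_)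
        refine genCos_initPhase_ne_zero hx hv hα fun h0 => ?_
        have := hcon j (mem_J.2 hα) (htau.trans (by rw [h]))
        rw [covector_eq_zero_iff hx hφ hα] at h0
        exact h0.elim this.1 this.2
      · exact hfocal j (mem_J.2 hα) _ (hτ j₀ hj₀).1 h
    obtain ⟨ε, hε, hball⟩ := Metric.eventually_nhds_iff.1 hnear
    -- No conjugate time lies before `τ`, and none lies within `ε` after it.
    have hge : ((tauComp α x₀ φ j₀ + ε : ℝ) : EReal) ≤ conjTime α x₀ (covector α x₀ φ) := by
      refine le_iInf₂ fun t ht => EReal.coe_le_coe_iff.2 (not_lt.1 fun hlt => ?_)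
      have h1 : (tauComp α x₀ φ j₀ : EReal) ≤ t := by
        rw [← htau]
        exact hle.trans (iInf₂_le t ht)
      rw [EReal.coe_le_coe_iff] at h1
      refine not_isCriticalCovector_smul hx hv ht.1 (hball ?_) ht.2
      rw [Real.dist_eq, abs_of_nonneg (by linarith)]
      linarith
    rw [← heq, htau, EReal.coe_le_coe_iff] at hge
    linarith
  · rintro ⟨j, hj, htau, hφj⟩
    have hα := mem_J.1 hj
    refine le_antisymm hle ?_
    rw [htau]
    exact iInf₂_le _ ⟨(hτ j hj).1, isCriticalCovector_smul hx hv (hτ j hj).1 hα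
      ((covector_eq_zero_iff hx hφ hα).2 hφj) (hτ j hj).2⟩

end ConjTime

end

end Grushin

theorem mainTheorem4 (n : ℕ) (α : Fin n → ℕ) (x₀ : Fin (n + 1) → ℝ)
    (hx₀ : Grushin.IsRiemannianPoint α x₀)
    (φ : Fin n → ℝ) (hφ : φ ∈ Grushin.rectangle0 α) :
    (∀ j ∈ Grushin.J α, IsLeast (Grushin.tauSet α x₀ φ j) (Grushin.tauComp α x₀ φ j)) ∧
    0 < Grushin.tau α x₀ φ ∧
    Grushin.tau α x₀ φ ≤ Grushin.conjTime α x₀ (Grushin.covector α x₀ φ) ∧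
    ((Grushin.J α).Nonempty →
      (Grushin.tau α x₀ φ = Grushin.conjTime α x₀ (Grushin.covector α x₀ φ) ↔
        ∃ j ∈ Grushin.J α, Grushin.tau α x₀ φ = (Grushin.tauComp α x₀ φ j : EReal) ∧
          (φ j = Grushin.genPi (α j) / 2 ∨ φ j = 3 * Grushin.genPi (α j) / 2))) :=
  Grushin.isLeast_tauComp_and_tau_le_conjTime n α x₀ hx₀ φ hφ
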